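/- Conventions. A graph is finite and connected, with loops and parallel edges allowed: it has a nonempty set $V(G)$ of vertices, a set $H(G)$ of half-edges, a root map $r: H(G)\to V(G)$ and a fixed-point free involution $s$ of $H(G)$; its edges are the $s$-orbits, $E(G)=H(G)/s$, and $b^1(G)=|E(G)|-|V(G)|+1$. For integers $g,n\ge 0$, a stable $n$-marked graph of genus $g$ is a triple $\mathbf G=(G,w,m)$ with $w:V(G)\to\mathbb Z_{\ge 0}$ and $m:\{1,\dots,n\}\to V(G)$ such that $b^1(G)+\sum_v w(v)=g$ and $2w(v)-2+\operatorname{val}(v)+|m^{-1}(v)|>0$ for all $v\in V(G)$, where $\operatorname{val}(v)=|r^{-1}(v)|$. Contracting a loop removes it and adds $1$ to the weight of its vertex; contracting a non-loop edge removes it and merges its two ends into one vertex, whose weight is the sum of their weights and which carries the markings of both. Let $[p]=\{0,\dots,p\}$ for $p\ge 0$ and $[-1]=\varnothing$, and let $\mathrm I$ be the category of the sets $[p]$, $p\geq -1$, with all injections as morphisms. A symmetric $\Delta$-complex is a functor $\mathrm I^{\mathrm{op}}\to\mathsf{Set}$, a subcomplex is a subfunctor, and $\operatorname{Aut}$ denotes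 the group of natural automorphisms. Define the symmetric $\Delta$-complex $\Delta_{g,n}$ as follows: $\Delta_{g,n}[p]$ is the set of isomorphism classes $[\mathbf G,\tau]$ of pairs of a stable $n$-marked graph $\mathbf G$ of genus $g$ and a bijection $\tau:E(\mathbf G)\to[p]$ (isomorphisms respect $r$, $s$, $w$, $m$ and $\tau$). For an injection $\iota:[p]\to[q]$, the map $\Delta_{g,n}(\iota):\Delta_{g,n}[q]\to\Delta_{g,n}[p]$ contracts all edges whose label is not in $\iota([p])$, and labels each remaining edge by the preimage of its old label under $\iota$. For $i\ge 1$, let $\mathsf V^i_{g,n}\subseteq\Delta_{g,n}$ be the subcomplex of the classes $[\mathbf G,\tau]$ with $|V(\mathbf G)|\le i$. Theorem. Let $g,n\ge 0$ be integers such that $2g-2+n\ge 3$. Then every automorphism of $\Delta_{g,n}$ restricts to an automorphism of $\mathsf V^2_{g,n}$, and the resulting restriction homomorphism $$\rho^2_{g,n}:\operatorname{Aut}(\Delta_{g,n})\to\operatorname{Aut}(\mathsf V^2_{g,n})$$ is injective. -/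

import Mathlib

open CategoryTheory

/-! ## Graphs -/

/-- A finite graph, given by vertices `V`, half-edges `H`, the root map `r` that sends a half-edge
to its incident vertex, and the fixed-point free involution `s` that couples half-edges.
Loops and parallel edges are allowed. -/
structure HGraph where
  V : Type
  H : Type
  [fintypeV : Fintype V]
  [fintypeH : Fintype H]
  r : H → V
  s : H → H
  s_s : ∀ h, s (s h) = h
  s_ne : ∀ h, s h ≠ h

namespace HGraph

attribute [instance] HGraph.fintypeV HGraph.fintypeH

variable (G : HGraph)

/-- Two half-edges belong to the same edge. -/
def edgeSetoid : Setoid G.H where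
  r h h' := h' = h ∨ h' = G.s h
  iseqv :=
    { refl := fun _ => Or.inl rfl
      symm := by
        rintro h h' (rfl | rfl)
        · exact Or.inl rfl
        · exact Or.inr (G.s_s h).symm
      trans := by
        rintro a b c (rfl | rfl) (rfl | rfl)
        · exact Or.inl rfl
        · exact Or.inr rfl
        · exact Or.inr rfl
        · exact Or.inl (G.s_s a) }

/-- The set of edges `H / (h ∼ s h)`. -/
def E : Type := Quotient G.edgeSetoid

/-- The edge that contains a half-edge. -/
def edge (h : G.H) : G.E := Quotient.mk G.edgeSetoid h

noncomputable instance : Fintype G.E :=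
  have : Finite G.E := inferInstanceAs (Finite (Quotient G.edgeSetoid))
  Fintype.ofFinite G.E

/-- The equivalence relation on vertices whose classes are the connected components of the subgraph
with all the vertices of `G` and only the edges in `S`. -/
def joined (S : Set G.E) : Setoid G.V :=
  Relation.EqvGen.setoid fun u v => ∃ h, G.edge h ∈ S ∧ G.r h = u ∧ G.r (G.s h) = v

/-- `G` is connected (and nonempty). -/
def Connected : Prop := Nonempty G.V ∧ ∀ u v, G.joined Set.univ u v

/-- The first Betti number `|E| - |V| + 1` of a connected graph. -/
noncomputable def betti : ℤ := (Fintype.card G.E : ℤ) - Fintype.card G.V + 1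

open scoped Classical in
/-- The valence of a vertex: the number of half-edges at it (so a loop counts twice). -/
noncomputable def val (v : G.V) : ℕ := (Finset.univ.filter fun h => G.r h = v).card

/-- The set of connected components of the subgraph formed by the edges in `S`. -/
def Comp (S : Set G.E) : Type := Quotient (G.joined S)

/-- The component of a vertex. -/
def comp (S : Set G.E) (v : G.V) : G.Comp S := Quotient.mk (G.joined S) v

noncomputable instance (S : Set G.E) : Fintype (G.Comp S) :=
  have : Finite (G.Comp S) := inferInstanceAs (Finite (Quotient (G.joined S)))
  Fintype.ofFinite _

open scoped Classical in
/-- The edges in `S` that lie in the component `c`. -/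
noncomputable def compEdges (S : Set G.E) (c : G.Comp S) : Finset G.E :=
  Finset.univ.filter fun e => e ∈ S ∧ ∃ h, G.edge h = e ∧ G.comp S (G.r h) = c

open scoped Classical in
/-- The vertices of the component `c`. -/
noncomputable def compVerts (S : Set G.E) (c : G.Comp S) : Finset G.V :=
  Finset.univ.filter fun v => G.comp S v = c

/-- The first Betti number `|E| - |V| + 1` of the component `c`.  The subtraction never truncates
(see `card_compVerts_le`). -/
noncomputable def compBetti (S : Set G.E) (c : G.Comp S) : ℕ :=
  (G.compEdges S c).card + 1 - (G.compVerts S c).card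

open scoped Classical in
/-- The underlying graph of the contraction of all edges in `S`: every component of the subgraph
formed by `S` becomes one vertex, and the half-edges of `S` are removed. -/
noncomputable def contract (S : Set G.E) : HGraph where
  V := G.Comp S
  H := {h : G.H // G.edge h ∉ S}
  r h := G.comp S (G.r h.1)
  s h := ⟨G.s h.1, by
    have : G.edge (G.s h.1) = G.edge h.1 := Quotient.sound (s := G.edgeSetoid) (Or.inr (G.s_s _).symm)
    rw [this]; exact h.2⟩
  s_s h := Subtype.ext (G.s_s _)
  s_ne h hh := G.s_ne h.1 (congrArg Subtype.val hh)

variable {G}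

lemma edge_eq_iff {h h' : G.H} : G.edge h = G.edge h' ↔ h' = h ∨ h' = G.s h :=
  Quotient.eq (r := G.edgeSetoid)

lemma edge_s (h : G.H) : G.edge (G.s h) = G.edge h :=
  edge_eq_iff.2 (Or.inr (G.s_s _).symm)

lemma edge_surj (e : G.E) : ∃ h, G.edge h = e := Quotient.exists_rep (s := G.edgeSetoid) e

lemma comp_eq_iff {S : Set G.E} {u v : G.V} : G.comp S u = G.comp S v ↔ G.joined S u v :=
  Quotient.eq (r := G.joined S)

lemma comp_surj (S : Set G.E) (c : G.Comp S) : ∃ v, G.comp S v = c :=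
  Quotient.exists_rep (s := G.joined S) c

lemma comp_r_s {S : Set G.E} {h : G.H} (hh : G.edge h ∈ S) :
    G.comp S (G.r (G.s h)) = G.comp S (G.r h) :=
  (comp_eq_iff.2 (Relation.EqvGen.rel _ _ ⟨h, hh, rfl, rfl⟩)).symm

lemma comp_r_eq {S : Set G.E} {h h' : G.H} (hh : G.edge h ∈ S) (he : G.edge h = G.edge h') :
    G.comp S (G.r h') = G.comp S (G.r h) := by
  rcases edge_eq_iff.1 he with rfl | rfl
  · rfl
  · exact comp_r_s hh

open scoped Classical in
lemma card_halfEdges (e : G.E) : (Finset.univ.filter fun h => G.edge h = e).card = 2 := by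
  obtain ⟨h, rfl⟩ := edge_surj e
  have : (Finset.univ.filter fun h' => G.edge h' = G.edge h) = {h, G.s h} := by
    ext h'
    simp only [Finset.mem_filter, Finset.mem_univ, true_and, Finset.mem_insert,
      Finset.mem_singleton]
    rw [eq_comm, edge_eq_iff]
  rw [this, Finset.card_pair (G.s_ne h).symm]

/-- A connected component with `k` vertices has at least `k - 1` edges. -/
lemma card_compVerts_le (S : Set G.E) (c : G.Comp S) :
    (G.compVerts S c).card ≤ (G.compEdges S c).card + 1 := by
  classical
  let W := {v : G.V // G.comp S v = c}
  let K : SimpleGraph W :=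
    { Adj := fun u v => u ≠ v ∧ ∃ h, G.edge h ∈ S ∧ G.r h = u.1 ∧ G.r (G.s h) = v.1
      symm := ⟨by
        rintro u v ⟨hne, h, hS, hu, hv⟩
        exact ⟨hne.symm, G.s h, by rwa [edge_s], hv, by rwa [G.s_s]⟩⟩
      loopless := ⟨fun u hu => hu.1 rfl⟩ }
  have key : ∀ u v, G.joined S u v → ∀ (hu : G.comp S u = c) (hv : G.comp S v = c),
      K.Reachable ⟨u, hu⟩ ⟨v, hv⟩ := by
    intro u v huv
    induction huv with
    | rel u v h =>
      intro hu hv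
      by_cases he : u = v
      · subst he; exact SimpleGraph.Reachable.refl _
      · exact SimpleGraph.Adj.reachable ⟨fun h => he (congrArg Subtype.val h), h⟩
    | refl u => intro hu hv; exact SimpleGraph.Reachable.refl _
    | symm u v _ ih => intro hu hv; exact (ih hv hu).symm
    | trans u v w huv _ ih1 ih2 =>
      intro hu hw
      have hv : G.comp S v = c := by rw [← hu]; exact (comp_eq_iff.2 huv).symm
      exact (ih1 hu hv).trans (ih2 hv hw)
  obtain ⟨v0, hv0⟩ := comp_surj S c
  have hconn : K.Connected :=
    { preconnected := fun u v => key u.1 v.1 (comp_eq_iff.1 (u.2.trans v.2.symm)) u.2 v.2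
      nonempty := ⟨⟨v0, hv0⟩⟩ }
  have h1 := hconn.card_vert_le_card_edgeSet_add_one
  have h2 : Nat.card W = (G.compVerts S c).card := by
    rw [Nat.card_eq_fintype_card, Fintype.card_subtype, compVerts]
  let ends : G.E → Sym2 G.V := Quotient.lift (s := G.edgeSetoid)
    (fun h => s(G.r h, G.r (G.s h))) (by
      rintro h h' (rfl | rfl)
      · rfl
      · simp only [G.s_s]; exact Sym2.eq_swap)
  have h3 : Nat.card K.edgeSet ≤ (G.compEdges S c).card := by
    have hinj : Function.Injective (Sym2.map (Subtype.val : W → G.V)) :=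
      Sym2.map.injective Subtype.val_injective
    have hsub : Sym2.map (Subtype.val : W → G.V) '' K.edgeSet
        ⊆ ((G.compEdges S c).image ends : Finset (Sym2 G.V)) := by
      rintro _ ⟨e, he, rfl⟩
      induction e using Sym2.ind with
      | _ u v =>
        obtain ⟨_, h, hS, hu, hv⟩ := he
        simp only [Finset.coe_image, Set.mem_image, Finset.mem_coe]
        refine ⟨G.edge h, ?_, ?_⟩
        · simp only [compEdges, Finset.mem_filter, Finset.mem_univ, true_and]
          exact ⟨hS, h, rfl, by rw [hu]; exact u.2⟩
        · change s(G.r h, G.r (G.s h)) = _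
          rw [hu, hv]; rfl
    calc Nat.card K.edgeSet = (Sym2.map (Subtype.val : W → G.V) '' K.edgeSet).ncard := by
          rw [Set.ncard_image_of_injective _ hinj]; rfl
      _ ≤ ((G.compEdges S c).image ends : Finset (Sym2 G.V)).card := by
          rw [← Set.ncard_coe_finset]
          exact Set.ncard_le_ncard hsub (Finset.finite_toSet _)
      _ ≤ _ := Finset.card_image_le
  omega

open scoped Classical in
/-- Every edge in `S` lies in exactly one component. -/
lemma sum_card_compEdges (S : Set G.E) :
    ∑ c, (G.compEdges S c).card = (Finset.univ.filter fun e => e ∈ S).card := by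
  choose p hp using fun e : G.E => edge_surj e
  rw [Finset.card_eq_sum_card_fiberwise (f := fun e => G.comp S (G.r (p e))) (t := Finset.univ)
    (fun _ _ => Finset.mem_coe.2 (Finset.mem_univ _))]
  refine Finset.sum_congr rfl fun c _ => congrArg Finset.card ?_
  ext e
  simp only [compEdges, Finset.mem_filter, Finset.mem_univ, true_and]
  refine and_congr_right fun he => ⟨?_, fun h => ⟨p e, hp e, h⟩⟩
  rintro ⟨h, rfl, rfl⟩
  exact comp_r_eq he (hp _).symm

open scoped Classical in
/-- The half-edges of `G` rooted in the component `c` are those of `G / S` rooted at `c` together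
with two for every edge in `S` that lies in `c`. -/
lemma sum_val_comp (S : Set G.E) (c : G.Comp S) :
    ∑ v ∈ G.compVerts S c, G.val v = (G.contract S).val c + 2 * (G.compEdges S c).card := by
  have h1 : ∑ v ∈ G.compVerts S c, G.val v
      = (Finset.univ.filter fun h => G.comp S (G.r h) = c).card := by
    rw [Finset.card_eq_sum_card_fiberwise (f := G.r) (t := G.compVerts S c)]
    · refine Finset.sum_congr rfl fun v hv => congrArg Finset.card ?_
      ext h
      simp only [compVerts, Finset.mem_filter, Finset.mem_univ, true_and] at hv ⊢
      constructor
      · rintro rfl; exact ⟨hv, rfl⟩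
      · exact fun h => h.2
    · intro h hh
      simpa [compVerts] using hh
  have h2 : (G.contract S).val c
      = (Finset.univ.filter fun h => G.comp S (G.r h) = c ∧ G.edge h ∉ S).card := by
    unfold val
    refine Finset.card_bij (fun h _ => h.1) ?_ ?_ ?_
    · intro h hh
      simp only [Finset.mem_filter, Finset.mem_univ, true_and] at hh ⊢
      exact ⟨hh, h.2⟩
    · intro a _ b _ h; exact Subtype.ext h
    · intro h hh
      simp only [Finset.mem_filter, Finset.mem_univ, true_and] at hh
      exact ⟨⟨h, hh.2⟩, Finset.mem_filter.2 ⟨Finset.mem_univ _, hh.1⟩, rfl⟩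
  have h3 : 2 * (G.compEdges S c).card
      = (Finset.univ.filter fun h => G.comp S (G.r h) = c ∧ G.edge h ∈ S).card := by
    rw [Finset.card_eq_sum_card_fiberwise (f := G.edge) (t := G.compEdges S c)]
    · rw [mul_comm, ← smul_eq_mul, ← Finset.sum_const]
      refine Finset.sum_congr rfl fun e he => ?_
      rw [← card_halfEdges e]
      congr 1
      ext h
      simp only [compEdges, Finset.mem_filter, Finset.mem_univ, true_and] at he ⊢
      obtain ⟨hS, h', rfl, hc⟩ := he
      refine ⟨fun hh => ⟨⟨?_, by rwa [hh]⟩, hh⟩, fun hh => hh.2⟩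
      rw [comp_r_eq hS hh.symm, hc]
    · intro h hh
      simp only [Finset.coe_filter, Finset.mem_univ, true_and, Set.mem_ofPred_eq, compEdges] at hh ⊢
      exact ⟨hh.2, h, rfl, hh.1⟩
  rw [h1, h2, h3]
  have h4 := Finset.card_filter_add_card_filter_not
    (s := Finset.univ.filter fun h => G.comp S (G.r h) = c) (fun h => G.edge h ∉ S)
  simp only [Finset.filter_filter, not_not] at h4
  exact h4.symm

/-- The edges of `G / S` are the edges of `G` outside `S`; this is the map `E(G / S) → E(G)` that
the contraction induces. -/
noncomputable def contractEdge (S : Set G.E) : (G.contract S).E ≃ {e : G.E // e ∉ S} :=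
  Equiv.ofBijective
    (Quotient.lift (s := (G.contract S).edgeSetoid)
      (fun h => (⟨G.edge h.1, h.2⟩ : {e : G.E // e ∉ S})) (by
        rintro h h' hh
        refine Subtype.ext (edge_eq_iff.2 ?_)
        exact hh.imp (congrArg Subtype.val) (congrArg Subtype.val)))
    (by
      constructor
      · intro a b
        obtain ⟨h, rfl⟩ := edge_surj a
        obtain ⟨h', rfl⟩ := edge_surj b
        intro hh
        refine edge_eq_iff.2 ?_
        exact (edge_eq_iff.1 (congrArg Subtype.val hh)).imp Subtype.ext
          (fun x => Subtype.ext x)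
      · rintro ⟨e, he⟩
        obtain ⟨h, rfl⟩ := edge_surj e
        exact ⟨(G.contract S).edge ⟨h, he⟩, rfl⟩)

lemma contractEdge_edge (S : Set G.E) (h : (G.contract S).H) :
    (contractEdge S ((G.contract S).edge h)).1 = G.edge h.1 := rfl

lemma contract_connected (hG : G.Connected) (S : Set G.E) : (G.contract S).Connected := by
  obtain ⟨⟨v0⟩, hG⟩ := hG
  refine ⟨⟨G.comp S v0⟩, fun a b => ?_⟩
  obtain ⟨u, rfl⟩ := comp_surj S a
  obtain ⟨v, rfl⟩ := comp_surj S b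
  have := hG u v
  change Relation.EqvGen _ _ _
  induction this with
  | rel u v h =>
    obtain ⟨h, -, rfl, rfl⟩ := h
    by_cases hS : G.edge h ∈ S
    · rw [comp_r_s hS]; exact Relation.EqvGen.refl _
    · exact Relation.EqvGen.rel _ _ ⟨⟨h, hS⟩, trivial, rfl, rfl⟩
  | refl u => exact Relation.EqvGen.refl _
  | symm u v _ ih => exact Relation.EqvGen.symm _ _ ih
  | trans u v w _ _ ih1 ih2 => exact Relation.EqvGen.trans _ _ _ ih1 ih2

end HGraph

/-! ## Stable weighted marked graphs -/

/-- A stable `n`-marked weighted graph of genus `g`: a connected graph with vertex weights `w` such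
that `b¹ + ∑ w = g`, and with a marking function `m` such that `2 w(v) - 2 + val(v) + |m⁻¹(v)| > 0`
at every vertex. -/
structure StableGraph (g n : ℕ) extends HGraph where
  connected : toHGraph.Connected
  w : V → ℕ
  m : Fin n → V
  genus : toHGraph.betti + ∑ v, (w v : ℤ) = g
  stable : ∀ v, 0 < 2 * (w v : ℤ) - 2 + toHGraph.val v + Nat.card {i : Fin n // m i = v}

namespace StableGraph

variable {g n : ℕ} (G : StableGraph g n)

/-- The weight of a vertex of `G / S`: the sum of the weights of the vertices that are merged into
it, plus the first Betti number of the contracted component.  For a single edge this adds one if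
the edge is a loop, and adds the two weights at its ends otherwise. -/
noncomputable def contractWeight (S : Set G.E) (c : G.Comp S) : ℕ :=
  (∑ v ∈ G.compVerts S c, G.w v) + G.compBetti S c

lemma contractWeight_sub_one (S : Set G.E) (c : G.Comp S) :
    (G.contractWeight S c : ℤ) - 1
      = ∑ v ∈ G.compVerts S c, ((G.w v : ℤ) - 1) + (G.compEdges S c).card := by
  have h := HGraph.card_compVerts_le S c
  rw [contractWeight, HGraph.compBetti, Finset.sum_sub_distrib]
  push_cast [Nat.cast_sub h]
  simp
  ring

/-- The contraction `G / S` of a set `S` of edges. -/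
noncomputable def contract (S : Set G.E) : StableGraph g n where
  toHGraph := G.toHGraph.contract S
  connected := HGraph.contract_connected G.connected S
  w := G.contractWeight S
  m i := G.comp S (G.m i)
  genus := by
    classical
    have h1 := G.genus
    have hE : Fintype.card (G.toHGraph.contract S).E + (Finset.univ.filter fun e => e ∈ S).card
        = Fintype.card G.E := by
      rw [Fintype.card_congr (HGraph.contractEdge S), Fintype.card_subtype, add_comm]
      exact Finset.card_filter_add_card_filter_not (s := Finset.univ) (fun e => e ∈ S)
    have hs : ∑ c : G.Comp S, ((G.contractWeight S c : ℤ) - 1)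
        = ∑ v, ((G.w v : ℤ) - 1) + (Finset.univ.filter fun e => e ∈ S).card := by
      rw [← HGraph.sum_card_compEdges S]
      simp only [contractWeight_sub_one]
      rw [Finset.sum_add_distrib]
      push_cast
      congr 1
      exact Finset.sum_fiberwise Finset.univ (G.comp S) fun v => (G.w v : ℤ) - 1
    rw [Finset.sum_sub_distrib, Finset.sum_sub_distrib] at hs
    simp only [Finset.sum_const, Finset.card_univ, nsmul_eq_mul, mul_one] at hs
    have hV : Fintype.card (G.toHGraph.contract S).V = Fintype.card (G.Comp S) :=
      Fintype.card_congr (Equiv.refl _)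
    have hw : ∑ v : (G.toHGraph.contract S).V, (G.contractWeight S v : ℤ)
        = ∑ c : G.Comp S, (G.contractWeight S c : ℤ) :=
      Fintype.sum_equiv (Equiv.refl _) _ _ fun _ => rfl
    rw [HGraph.betti] at h1 ⊢
    rw [hV, hw]
    have hE' : (Fintype.card (G.toHGraph.contract S).E : ℤ)
        + (Finset.univ.filter fun e => e ∈ S).card = Fintype.card G.E := by exact_mod_cast hE
    linarith
  stable := by
    classical
    intro (c : G.Comp S)
    change 0 < 2 * (G.contractWeight S c : ℤ) - 2 + (G.toHGraph.contract S).val c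
      + Nat.card {i : Fin n // G.comp S (G.m i) = c}
    have hv := HGraph.sum_val_comp S c
    have hw := G.contractWeight_sub_one S c
    have hm : ∑ v ∈ G.compVerts S c, Nat.card {i : Fin n // G.m i = v}
        = Nat.card {i : Fin n // G.comp S (G.m i) = c} := by
      simp only [Nat.card_eq_fintype_card, Fintype.card_subtype]
      rw [Finset.card_eq_sum_card_fiberwise (f := G.m) (t := G.compVerts S c)]
      · refine Finset.sum_congr rfl fun v hv => congrArg Finset.card ?_
        ext h
        simp only [HGraph.compVerts, Finset.mem_filter, Finset.mem_univ, true_and] at hv ⊢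
        constructor
        · rintro rfl; exact ⟨hv, rfl⟩
        · exact fun h => h.2
      · intro h hh
        simpa [HGraph.compVerts] using hh
    have hpos : 0 < ∑ v ∈ G.compVerts S c, (2 * ((G.w v : ℤ) - 1) + G.val v
        + Nat.card {i : Fin n // G.m i = v}) := by
      refine Finset.sum_pos (fun v _ => ?_) ?_
      · have := G.stable v; linarith
      · obtain ⟨v, hv⟩ := HGraph.comp_surj S c
        exact ⟨v, by simpa [HGraph.compVerts] using hv⟩
    rw [Finset.sum_add_distrib, Finset.sum_add_distrib, ← Finset.mul_sum] at hpos
    have hv' : ∑ v ∈ G.compVerts S c, (G.val v : ℤ)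
        = (G.toHGraph.contract S).val c + 2 * (G.compEdges S c).card := by exact_mod_cast hv
    have hm' : ∑ v ∈ G.compVerts S c, (Nat.card {i : Fin n // G.m i = v} : ℤ)
        = Nat.card {i : Fin n // G.comp S (G.m i) = c} := by exact_mod_cast hm
    rw [hv', hm'] at hpos
    linarith

end StableGraph

/-! ## Edge-labelled pairs -/

/-- An edge-labelled pair: a stable graph with a bijective labelling of its edges by
`Fin k = {0, …, k - 1}`. -/
structure LabelledGraph (g n k : ℕ) where
  graph : StableGraph g n
  label : graph.E ≃ Fin k

namespace LabelledGraph

variable {g n : ℕ}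

/-- The label of the edge that contains the half-edge `h`. -/
def lab {k : ℕ} (A : LabelledGraph g n k) (h : A.graph.H) : Fin k := A.label (A.graph.edge h)

/-- An isomorphism of edge-labelled pairs: bijections on vertices and on half-edges that respect the
root map, the coupling of half-edges, the weights, the markings and the edge labels. -/
structure Iso {k : ℕ} (A B : LabelledGraph g n k) where
  onV : A.graph.V ≃ B.graph.V
  onH : A.graph.H ≃ B.graph.H
  map_r : ∀ h, onV (A.graph.r h) = B.graph.r (onH h)
  map_s : ∀ h, onH (A.graph.s h) = B.graph.s (onH h)
  map_w : ∀ v, B.graph.w (onV v) = A.graph.w v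
  map_m : ∀ i, onV (A.graph.m i) = B.graph.m i
  map_lab : ∀ h, B.lab (onH h) = A.lab h

/-- Isomorphism of edge-labelled pairs, as an equivalence relation. -/
def isoSetoid (g n k : ℕ) : Setoid (LabelledGraph g n k) where
  r A B := Nonempty (Iso A B)
  iseqv :=
    { refl := fun A => ⟨⟨Equiv.refl _, Equiv.refl _, fun _ => rfl, fun _ => rfl, fun _ => rfl,
        fun _ => rfl, fun _ => rfl⟩⟩
      symm := by
        rintro A B ⟨φ⟩
        refine ⟨⟨φ.onV.symm, φ.onH.symm, fun h => ?_, fun h => ?_, fun v => ?_, fun i => ?_,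
          fun h => ?_⟩⟩
        · rw [Equiv.symm_apply_eq, φ.map_r, Equiv.apply_symm_apply]
        · rw [Equiv.symm_apply_eq, φ.map_s, Equiv.apply_symm_apply]
        · rw [← φ.map_w, Equiv.apply_symm_apply]
        · rw [Equiv.symm_apply_eq, φ.map_m]
        · rw [← φ.map_lab, Equiv.apply_symm_apply]
      trans := by
        rintro A B C ⟨φ⟩ ⟨ψ⟩
        exact ⟨⟨φ.onV.trans ψ.onV, φ.onH.trans ψ.onH, fun h => by simp [φ.map_r, ψ.map_r],
          fun h => by simp [φ.map_s, ψ.map_s], fun v => by simp [φ.map_w, ψ.map_w],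
          fun i => by simp [φ.map_m, ψ.map_m], fun h => by simp [φ.map_lab, ψ.map_lab]⟩⟩ }

/-- The edges of `A` whose label is not in the image of `ι`. -/
def missed {j k : ℕ} (A : LabelledGraph g n k) (ι : Fin j ↪ Fin k) : Set A.graph.E :=
  {e | A.label e ∉ Set.range ι}

/-- The face of an edge-labelled pair along an injection `ι`: contract all edges whose label is not
in the image of `ι`, and label the other edges so that `ι` sends the new label to the old one. -/
noncomputable def face {j k : ℕ} (ι : Fin j ↪ Fin k) (A : LabelledGraph g n k) :
    LabelledGraph g n j where
  graph := A.graph.contract (A.missed ι)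
  label := (HGraph.contractEdge (A.missed ι)).trans
    ((A.label.subtypeEquiv fun e => (not_not : ¬ e ∈ A.missed ι ↔ A.label e ∈ Set.range ι)).trans
      (Equiv.ofInjective ι ι.injective).symm)

lemma face_lab {j k : ℕ} (ι : Fin j ↪ Fin k) (A : LabelledGraph g n k)
    (h : (A.face ι).graph.H) : ι ((A.face ι).lab h) = A.lab h.1 :=
  congrArg Subtype.val ((Equiv.ofInjective ι ι.injective).apply_symm_apply _)

open scoped Classical in
/-- `B` is a contraction of `A` along `ι`, by a given map on vertices and a given map from the
half-edges of `B` to those of `A`. -/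
structure Contracts {j k : ℕ} (ι : Fin j ↪ Fin k) (A : LabelledGraph g n k)
    (B : LabelledGraph g n j) where
  f : A.graph.V → B.graph.V
  t : B.graph.H → A.graph.H
  f_surj : Function.Surjective f
  t_inj : Function.Injective t
  t_range : ∀ h, A.lab h ∈ Set.range ι → ∃ h', t h' = h
  lab_t : ∀ h, A.lab (t h) = ι (B.lab h)
  f_r : ∀ h, f (A.graph.r (t h)) = B.graph.r h
  t_s : ∀ h, t (B.graph.s h) = A.graph.s (t h)
  f_m : ∀ i, f (A.graph.m i) = B.graph.m i
  f_eq : ∀ u v, f u = f v ↔ A.graph.joined (A.missed ι) u v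
  f_w : ∀ c, (B.graph.w c : ℤ) - 1 = ∑ v with f v = c, ((A.graph.w v : ℤ) - 1)
    + (Finset.univ.filter fun i => i ∉ Set.range ι ∧
        ∃ h, A.lab h = i ∧ f (A.graph.r h) = c).card

noncomputable def contractsFace {j k : ℕ} (ι : Fin j ↪ Fin k) (A : LabelledGraph g n k) :
    Contracts ι A (A.face ι) where
  f := A.graph.comp (A.missed ι)
  t h := h.1
  f_surj := HGraph.comp_surj _
  t_inj _ _ h := Subtype.ext h
  t_range h hh := ⟨⟨h, not_not.2 hh⟩, rfl⟩
  lab_t h := (face_lab ι A h).symm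
  f_r _ := rfl
  t_s _ := rfl
  f_m _ := rfl
  f_eq _ _ := HGraph.comp_eq_iff
  f_w := by
    classical
    intro (c : A.graph.Comp (A.missed ι))
    refine (A.graph.contractWeight_sub_one (A.missed ι) c).trans ?_
    congr 2
    refine Finset.card_bij (fun e _ => A.label e) ?_ ?_ ?_
    · intro e he
      simp only [HGraph.compEdges, Finset.mem_filter, Finset.mem_univ, true_and] at he ⊢
      obtain ⟨hS, h, rfl, hc⟩ := he
      exact ⟨hS, h, rfl, hc⟩
    · intro a _ b _ h; exact A.label.injective h
    · intro i hi
      simp only [Finset.mem_filter, Finset.mem_univ, true_and] at hi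
      obtain ⟨hi, h, rfl, hc⟩ := hi
      refine ⟨A.graph.edge h, ?_, rfl⟩
      simp only [HGraph.compEdges, Finset.mem_filter, Finset.mem_univ, true_and]
      exact ⟨hi, h, rfl, hc⟩

lemma lab_eq_iff {k : ℕ} (A : LabelledGraph g n k) {h h' : A.graph.H} :
    A.lab h = A.lab h' ↔ h' = h ∨ h' = A.graph.s h :=
  A.label.injective.eq_iff.trans HGraph.edge_eq_iff

lemma lab_surj {k : ℕ} (A : LabelledGraph g n k) (i : Fin k) : ∃ h, A.lab h = i := by
  obtain ⟨h, hh⟩ := HGraph.edge_surj (A.label.symm i)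
  exact ⟨h, by rw [lab, hh, Equiv.apply_symm_apply]⟩

lemma lab_s {k : ℕ} (A : LabelledGraph g n k) (h : A.graph.H) :
    A.lab (A.graph.s h) = A.lab h := congrArg A.label (HGraph.edge_s h)

lemma joined_missed_mono {j k : ℕ} {A : LabelledGraph g n k} {P : A.graph.V → A.graph.V → Prop}
    (hP : Equivalence P) (ι : Fin j ↪ Fin k)
    (hs : ∀ h, A.lab h ∉ Set.range ι → P (A.graph.r h) (A.graph.r (A.graph.s h)))
    {u v : A.graph.V} (huv : A.graph.joined (A.missed ι) u v) : P u v := by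
  induction huv with
  | rel u v h => obtain ⟨h, hS, rfl, rfl⟩ := h; exact hs h hS
  | refl u => exact hP.refl u
  | symm u v _ ih => exact hP.symm ih
  | trans u v w _ _ ih1 ih2 => exact hP.trans ih1 ih2

lemma joined_edge {j k : ℕ} {A : LabelledGraph g n k} (ι : Fin j ↪ Fin k) {h : A.graph.H}
    (hh : A.lab h ∉ Set.range ι) :
    A.graph.joined (A.missed ι) (A.graph.r h) (A.graph.r (A.graph.s h)) :=
  Relation.EqvGen.rel _ _ ⟨h, hh, rfl, rfl⟩

/-- An isomorphism is a contraction of no edges. -/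
noncomputable def Iso.contracts {k : ℕ} {A B : LabelledGraph g n k} (φ : Iso A B) :
    Contracts (Function.Embedding.refl _) A B where
  f := φ.onV
  t := φ.onH.symm
  f_surj := φ.onV.surjective
  t_inj := φ.onH.symm.injective
  t_range h _ := ⟨φ.onH h, φ.onH.symm_apply_apply h⟩
  lab_t h := by rw [← φ.map_lab, Equiv.apply_symm_apply]; rfl
  f_r h := by rw [φ.map_r, Equiv.apply_symm_apply]
  t_s h := by rw [Equiv.symm_apply_eq, φ.map_s, Equiv.apply_symm_apply]
  f_m := φ.map_m
  f_eq u v := by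
    rw [φ.onV.injective.eq_iff]
    constructor
    · rintro rfl; exact Relation.EqvGen.refl _
    · exact joined_missed_mono ⟨fun _ => rfl, Eq.symm, Eq.trans⟩ _
        fun h hh => (hh ⟨A.lab h, rfl⟩).elim
  f_w c := by
    classical
    obtain ⟨v, rfl⟩ := φ.onV.surjective c
    have h1 : (Finset.univ.filter fun u => φ.onV u = φ.onV v) = {v} := by
      ext u; simp
    have h2 : (Finset.univ.filter fun i => i ∉ Set.range (Function.Embedding.refl (Fin k)) ∧
        ∃ h, A.lab h = i ∧ φ.onV (A.graph.r h) = φ.onV v) = ∅ := by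
      ext i; simp
    rw [h1, h2, φ.map_w]
    simp

/-- Two contractions along the same injection are isomorphic. -/
lemma Contracts.unique {j k : ℕ} {ι : Fin j ↪ Fin k} {A : LabelledGraph g n k}
    {B C : LabelledGraph g n j} (p : Contracts ι A B) (q : Contracts ι A C) :
    Nonempty (Iso B C) := by
  classical
  have hf : ∀ u v, p.f u = p.f v ↔ q.f u = q.f v := fun u v => (p.f_eq u v).trans (q.f_eq u v).symm
  choose x hx using p.f_surj
  choose y hy using q.f_surj
  have hp : ∀ h, ∃ h', q.t h' = p.t h := fun h => q.t_range _ ⟨_, (p.lab_t h).symm⟩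
  have hq : ∀ h, ∃ h', p.t h' = q.t h := fun h => p.t_range _ ⟨_, (q.lab_t h).symm⟩
  choose a ha using hp
  choose b hb using hq
  have hqx : ∀ u, q.f (x (p.f u)) = q.f u := fun u => (hf _ _).1 (hx _)
  let eV : B.graph.V ≃ C.graph.V :=
    { toFun := fun v => q.f (x v)
      invFun := fun v => p.f (y v)
      left_inv := fun v => by rw [← hx v, hf, hy, hx]
      right_inv := fun v => (hqx (y v)).trans (hy v) }
  let eH : B.graph.H ≃ C.graph.H :=
    { toFun := a
      invFun := b
      left_inv := fun h => p.t_inj (by rw [hb, ha])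
      right_inv := fun h => q.t_inj (by rw [ha, hb]) }
  have heV : ∀ u, eV (p.f u) = q.f u := hqx
  refine ⟨⟨eV, eH, fun h => ?_, fun h => ?_, fun v => ?_, fun i => ?_, fun h => ?_⟩⟩
  · rw [← p.f_r, heV, ← q.f_r]; exact congrArg (fun z => q.f (A.graph.r z)) (ha h).symm
  · apply q.t_inj
    rw [q.t_s]
    exact (ha _).trans ((p.t_s h).trans (congrArg A.graph.s (ha h).symm))
  · have h1 := p.f_w v
    have h2 := q.f_w (eV v)
    have hiff : ∀ u, q.f u = eV v ↔ p.f u = v := fun u => by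
      rw [← heV, eV.injective.eq_iff]
    simp only [hiff] at h2
    have : (C.graph.w (eV v) : ℤ) = B.graph.w v := by linarith
    exact_mod_cast this
  · rw [← p.f_m, heV, q.f_m]
  · apply ι.injective
    rw [← q.lab_t, ← p.lab_t]; exact congrArg A.lab (ha h)

/-- Contractions compose. -/
noncomputable def Contracts.comp {i j k : ℕ} {κ : Fin i ↪ Fin j} {ι : Fin j ↪ Fin k}
    {A : LabelledGraph g n k} {B : LabelledGraph g n j} {C : LabelledGraph g n i}
    (p : Contracts ι A B) (q : Contracts κ B C) : Contracts (κ.trans ι) A C where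
  f := q.f ∘ p.f
  t := p.t ∘ q.t
  f_surj := q.f_surj.comp p.f_surj
  t_inj := p.t_inj.comp q.t_inj
  t_range h := by
    rintro ⟨a, ha⟩
    obtain ⟨h', rfl⟩ := p.t_range h ⟨κ a, ha⟩
    have : B.lab h' = κ a := ι.injective (by rw [← p.lab_t, ← ha]; rfl)
    obtain ⟨h'', rfl⟩ := q.t_range h' ⟨a, this.symm⟩
    exact ⟨h'', rfl⟩
  lab_t h := by simp [p.lab_t, q.lab_t]
  f_r h := by simp [p.f_r, q.f_r]
  t_s h := by simp [p.t_s, q.t_s]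
  f_m x := by simp [p.f_m, q.f_m]
  f_eq u v := by
    have hmono : ∀ u v, A.graph.joined (A.missed ι) u v →
        A.graph.joined (A.missed (κ.trans ι)) u v := fun u v =>
      joined_missed_mono (A.graph.joined (A.missed (κ.trans ι))).iseqv ι fun h hh =>
        joined_edge _ fun ⟨a, ha⟩ => hh ⟨κ a, ha⟩
    constructor
    · intro huv
      obtain ⟨x, hx⟩ := p.f_surj.hasRightInverse
      have key : ∀ a b, B.graph.joined (B.missed κ) a b →
          A.graph.joined (A.missed (κ.trans ι)) (x a) (x b) := fun a b =>
        joined_missed_mono (P := fun a b => A.graph.joined (A.missed (κ.trans ι)) (x a) (x b))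
          ⟨fun _ => Setoid.refl' _ _, fun h => Setoid.symm' _ h, fun h h' => Setoid.trans' _ h h'⟩
          κ fun h hh => by
            have e1 := hmono _ _ ((p.f_eq _ _).1 ((hx _).trans (p.f_r h).symm))
            have e2 := hmono _ _ ((p.f_eq _ _).1 ((hx _).trans (p.f_r (B.graph.s h)).symm))
            rw [p.t_s] at e2
            refine Setoid.trans' _ e1 (Setoid.trans' _ ?_ (Setoid.symm' _ e2))
            refine joined_edge _ ?_
            rintro ⟨a, ha⟩
            refine hh ⟨a, ι.injective ?_⟩
            rw [← p.lab_t, ← ha]; rfl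
      have e := key _ _ ((q.f_eq _ _).1 huv)
      have e1 := hmono _ _ ((p.f_eq _ _).1 (hx (p.f u)))
      have e2 := hmono _ _ ((p.f_eq _ _).1 (hx (p.f v)))
      exact Setoid.trans' _ (Setoid.symm' _ e1) (Setoid.trans' _ e e2)
    · refine joined_missed_mono (P := fun a b => q.f (p.f a) = q.f (p.f b))
        ⟨fun _ => rfl, Eq.symm, Eq.trans⟩ _ fun h hh => ?_
      by_cases hι : A.lab h ∈ Set.range ι
      · obtain ⟨h', rfl⟩ := p.t_range h hι
        rw [← p.t_s, p.f_r, p.f_r]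
        refine (q.f_eq _ _).2 (joined_edge _ ?_)
        rintro ⟨a, ha⟩
        exact hh ⟨a, by rw [p.lab_t, ← ha]; rfl⟩
      · exact congrArg q.f ((p.f_eq _ _).2 (joined_edge _ hι))
  f_w c := by
    classical
    have h0 := q.f_w c
    simp only [p.f_w] at h0
    rw [h0, Finset.sum_add_distrib, add_assoc]
    congr 1
    · rw [← Finset.sum_fiberwise_of_maps_to (s := Finset.univ.filter fun v => (q.f ∘ p.f) v = c)
        (t := Finset.univ.filter fun v => q.f v = c) (g := p.f) (fun v hv => by simpa using hv)]
      refine Finset.sum_congr rfl fun v hv => Finset.sum_congr ?_ fun _ _ => rfl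
      ext u
      simp only [Finset.mem_filter, Finset.mem_univ, true_and, Function.comp_apply] at hv ⊢
      constructor
      · rintro rfl; exact ⟨hv, rfl⟩
      · exact fun h => h.2
    · choose z hz using A.lab_surj
      have hz' : ∀ l, l ∉ Set.range ι → ∀ h, A.lab h = l →
          p.f (A.graph.r h) = p.f (A.graph.r (z l)) := by
        intro l hl h hh
        rcases (A.lab_eq_iff (h := z l) (h' := h)).1 ((hz l).trans hh.symm) with rfl | rfl
        · rfl
        · exact ((p.f_eq _ _).2 (joined_edge ι (by rwa [hz]))).symm
      have h1 : ∑ v with q.f v = c, (Finset.univ.filter fun l => l ∉ Set.range ι ∧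
          ∃ h, A.lab h = l ∧ p.f (A.graph.r h) = v).card
          = (Finset.univ.filter fun l => l ∉ Set.range ι ∧
            ∃ h, A.lab h = l ∧ q.f (p.f (A.graph.r h)) = c).card := by
        rw [Finset.card_eq_sum_card_fiberwise (f := fun l => p.f (A.graph.r (z l)))
          (t := Finset.univ.filter fun v => q.f v = c)]
        · refine Finset.sum_congr rfl fun v hv => congrArg Finset.card ?_
          ext l
          simp only [Finset.mem_filter, Finset.mem_univ, true_and] at hv ⊢
          constructor
          · rintro ⟨hl, h, hh, rfl⟩
            exact ⟨⟨hl, h, hh, hv⟩, (hz' l hl h hh).symm⟩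
          · rintro ⟨⟨hl, h, hh, -⟩, hlv⟩
            exact ⟨hl, z l, hz l, hlv⟩
        · intro l hl
          simp only [Finset.coe_filter, Finset.mem_univ, true_and, Set.mem_ofPred_eq] at hl ⊢
          obtain ⟨hl, h, hh, hc⟩ := hl
          rw [← hz' l hl h hh, hc]
      have h2 : (Finset.univ.filter fun l => l ∉ Set.range κ ∧
            ∃ h, B.lab h = l ∧ q.f (B.graph.r h) = c).card
          = (Finset.univ.filter fun l => l ∈ Set.range ι ∧ l ∉ Set.range (κ.trans ι) ∧
            ∃ h, A.lab h = l ∧ q.f (p.f (A.graph.r h)) = c).card := by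
        refine Finset.card_bij (fun l _ => ι l) ?_ ?_ ?_
        · intro l hl
          simp only [Finset.mem_filter, Finset.mem_univ, true_and] at hl ⊢
          obtain ⟨hl, h, rfl, hc⟩ := hl
          refine ⟨⟨_, rfl⟩, ?_, p.t h, p.lab_t h, by rw [p.f_r, hc]⟩
          rintro ⟨a, ha⟩
          exact hl ⟨a, ι.injective ha⟩
        · intro a _ b _ hab; exact ι.injective hab
        · intro l hl
          simp only [Finset.mem_filter, Finset.mem_univ, true_and] at hl
          obtain ⟨hl, hl', h, rfl, hc⟩ := hl
          obtain ⟨h', rfl⟩ := p.t_range h hl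
          refine ⟨B.lab h', ?_, (p.lab_t h').symm⟩
          simp only [Finset.mem_filter, Finset.mem_univ, true_and]
          refine ⟨?_, h', rfl, by rw [← p.f_r, hc]⟩
          rintro ⟨a, ha⟩
          exact hl' ⟨a, by rw [p.lab_t, ← ha]; rfl⟩
      have h3 : (Finset.univ.filter fun l => l ∉ Set.range (κ.trans ι) ∧
            ∃ h, A.lab h = l ∧ (q.f ∘ p.f) (A.graph.r h) = c).card
          = (Finset.univ.filter fun l => l ∉ Set.range ι ∧
            ∃ h, A.lab h = l ∧ q.f (p.f (A.graph.r h)) = c).card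
          + (Finset.univ.filter fun l => l ∈ Set.range ι ∧ l ∉ Set.range (κ.trans ι) ∧
            ∃ h, A.lab h = l ∧ q.f (p.f (A.graph.r h)) = c).card := by
        rw [← Finset.card_union_of_disjoint]
        · congr 1
          ext l
          simp only [Finset.mem_filter, Finset.mem_univ, true_and, Finset.mem_union,
            Function.comp_apply]
          constructor
          · rintro ⟨hl, hh⟩
            by_cases hι : l ∈ Set.range ι
            · exact Or.inr ⟨hι, hl, hh⟩
            · exact Or.inl ⟨hι, hh⟩
          · rintro (⟨hι, hh⟩ | ⟨-, hl, hh⟩)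
            · exact ⟨fun ⟨a, ha⟩ => hι ⟨κ a, ha⟩, hh⟩
            · exact ⟨hl, hh⟩
        · rw [Finset.disjoint_left]
          intro l hl hl'
          simp only [Finset.mem_filter, Finset.mem_univ, true_and] at hl hl'
          exact hl.1 hl'.1
      rw [h3, ← h1, ← h2]
      push_cast
      rfl

lemma face_congr {j k : ℕ} (ι : Fin j ↪ Fin k) {A B : LabelledGraph g n k}
    (h : Nonempty (Iso A B)) : Nonempty (Iso (A.face ι) (B.face ι)) := by
  obtain ⟨φ⟩ := h
  have q : Contracts (ι.trans (Function.Embedding.refl _)) A (B.face ι) :=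
    φ.contracts.comp (contractsFace ι B)
  exact (contractsFace ι A).unique q

lemma face_refl {k : ℕ} (A : LabelledGraph g n k) :
    Nonempty (Iso (A.face (Function.Embedding.refl _)) A) := by
  obtain ⟨φ⟩ := (isoSetoid g n k).refl A
  exact (contractsFace _ A).unique φ.contracts

lemma face_face {i j k : ℕ} (κ : Fin i ↪ Fin j) (ι : Fin j ↪ Fin k) (A : LabelledGraph g n k) :
    Nonempty (Iso (A.face (κ.trans ι)) ((A.face ι).face κ)) :=
  (contractsFace _ A).unique ((contractsFace ι A).comp (contractsFace κ _))

end LabelledGraph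

/-! ## Symmetric Δ-complexes -/

/-- The category `I` of the finite sets `[p] = {0, …, p}` for `p ≥ -1` and all injections.  The
object of size `k` is `[k - 1]`, realized as `Fin k`; in particular `[-1]` is the empty set. -/
structure FinInj where
  size : ℕ

instance : Category FinInj where
  Hom a b := Fin a.size ↪ Fin b.size
  id _ := Function.Embedding.refl _
  comp κ ι := κ.trans ι

/-- Symmetric Δ-complexes: functors from `Iᵒᵖ` to sets, with natural transformations. -/
abbrev SymmetricDeltaComplex := FinInjᵒᵖ ⥤ Type 1

/-- The set `Δ_{g,n}[k - 1]` of isomorphism classes of stable, `n`-marked, edge-labelled pairs of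
genus `g` with `k` edges. -/
def TropSimplex (g n k : ℕ) : Type 1 := Quotient (LabelledGraph.isoSetoid g n k)

/-- The face map of `Δ_{g,n}` along an injection. -/
noncomputable def TropSimplex.face {g n j k : ℕ} (ι : Fin j ↪ Fin k) :
    TropSimplex g n k → TropSimplex g n j :=
  Quotient.map (sa := LabelledGraph.isoSetoid g n k) (sb := LabelledGraph.isoSetoid g n j)
    (LabelledGraph.face ι) fun _ _ h => LabelledGraph.face_congr ι h

/-- The symmetric Δ-complex `Δ_{g,n}`. -/
noncomputable def tropicalModuli (g n : ℕ) : SymmetricDeltaComplex where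
  obj a := TropSimplex g n a.unop.size
  map ι := TypeCat.ofHom (TropSimplex.face ι.unop)
  map_id a := by
    ext x
    obtain ⟨A, rfl⟩ := Quotient.exists_rep (s := LabelledGraph.isoSetoid g n _) x
    exact Quotient.sound (s := LabelledGraph.isoSetoid g n _) (LabelledGraph.face_refl A)
  map_comp ι κ := by
    ext x
    obtain ⟨A, rfl⟩ := Quotient.exists_rep (s := LabelledGraph.isoSetoid g n _) x
    exact Quotient.sound (s := LabelledGraph.isoSetoid g n _)
      (LabelledGraph.face_face κ.unop ι.unop A)

/-- The number of vertices of the graph that a simplex of `Δ_{g,n}` represents. -/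
def TropSimplex.numVertices {g n k : ℕ} : TropSimplex g n k → ℕ :=
  Quotient.lift (s := LabelledGraph.isoSetoid g n k) (fun A => Fintype.card A.graph.V)
    fun _ _ ⟨φ⟩ => Fintype.card_congr φ.onV

lemma TropSimplex.numVertices_face_le {g n j k : ℕ} (ι : Fin j ↪ Fin k) (x : TropSimplex g n k) :
    (x.face ι).numVertices ≤ x.numVertices := by
  obtain ⟨A, rfl⟩ := Quotient.exists_rep (s := LabelledGraph.isoSetoid g n _) x
  exact Fintype.card_le_of_surjective _ (LabelledGraph.contractsFace ι A).f_surj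

/-- The subcomplex `V^i_{g,n}` of `Δ_{g,n}` that consists of the graphs with at most `i`
vertices. -/
noncomputable def vertexSubcomplex (g n i : ℕ) : Subfunctor (tropicalModuli g n) where
  obj a := {x : TropSimplex g n a.unop.size | x.numVertices ≤ i}
  map ι x hx := (TropSimplex.numVertices_face_le ι.unop x).trans hx

/-- `ρ` is the restriction map from the automorphisms of a symmetric Δ-complex `X` to those of a
subcomplex `Y`: for every automorphism `Φ`, the automorphism `ρ Φ` of `Y` is the restriction of `Φ`
to `Y`. -/
def IsRestriction {X : SymmetricDeltaComplex} (Y : Subfunctor X) (ρ : Aut X →* Aut Y.toFunctor) :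
    Prop :=
  ∀ Φ : Aut X, (ρ Φ).hom ≫ Y.ι = Y.ι ≫ Φ.hom

/-! ## Incidence systems -/

/-! An automorphism is a family of bijections that commutes with contraction and relabelling of
edges. It preserves the number of vertices, and graphs with at least three vertices can be recovered
from graphs with fewer vertices. The first fact gives the restriction map, the second its
injectivity.

Number of vertices. It suffices that roses, the graphs with one vertex, go to roses
(`numVertices_eq_of_roses`): contracting the N - 1 edges of a spanning tree gives a rose, and a
contracted edge costs at most one vertex, so the image of a graph with N vertices has at most N
vertices; the inverse automorphism gives equality.

For a rose with one edge (`numVertices_one_edge`), consider the dipole with g + 1 parallel edges,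
all of whose one-edge faces are this loop. If the loop went to a bridge, the dipole would go to a
tree with g + 1 edges that all permutations of the labels preserve. Every edge then has its own leaf
without markings, which stability forces to have positive weight, and the total weight exceeds g.

For the rose with g loops (`numVertices_rose_of_genus_edges`), let T be the star with a loop at each
of g leaves, and let u be weightless such that its image has T as a face. Contracting a spanning
tree of u leaves g edges, each of which gives the loop as a one-edge face of u, hence also of the
image. In the image such an edge must be a loop of T: the bridges of T do not give the loop, and
neither does an edge contracted on the way to T, since T can be expanded by one edge only by
splitting its centre along a bridge. So the g edges are loops of T, and contracting everything else
leaves a rose. The other roses are faces of this one when g > 0.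

Reconstruction. Loops are the edges whose contraction keeps the number of vertices, so the image of
a graph has the same loop labels. By induction, the contractions of non-loop edges are fixed.
Trading weight for loops reduces to weightless graphs, and there `nonempty_iso_of_contractions`
applies. Its core is combinatorial: two connected systems with the same edges and markings and at
least three vertices, whose single-edge contractions agree, have the same sets of items at their
vertices (`Matching.exists_equiv`). A vertex off an edge e survives in the contraction of e, so its
set of items occurs in the other system unless it matches the merged vertex there. In that case the
two merged vertices have smaller degree, which permits an induction. -/

open scoped Classical in
/-- A family of sets of items, indexed by the vertices of a connected graph: an item in `N` is an
edge with two different ends, any other item (a loop or a marking) sits at a single vertex.  The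
items carry a multiplicity `c`, and the total multiplicity at every vertex is at least three. -/
structure IncidenceSystem (ι : Type) [Fintype ι] (N : Set ι) (c : ι → ℕ) where
  V : Type
  [fintypeV : Fintype V]
  inc : V → ι → Prop
  two_ends : ∀ e ∈ N, ∃ a b, a ≠ b ∧ ∀ x, inc x e ↔ x = a ∨ x = b
  one_end : ∀ i ∉ N, ∃ a, ∀ x, inc x i ↔ x = a
  conn : ∀ U : Set V, U.Nonempty → U ≠ Set.univ →
    ∃ e ∈ N, ∃ u ∈ U, ∃ v ∉ U, inc u e ∧ inc v e
  stable : ∀ v, 3 ≤ ∑ i with inc v i, c i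

namespace IncidenceSystem

attribute [instance] IncidenceSystem.fintypeV

variable {ι : Type} [Fintype ι] {N : Set ι} {c : ι → ℕ}

open scoped Classical in
/-- The number of items at a vertex, counted with multiplicity. -/
noncomputable def deg (X : IncidenceSystem ι N c) (v : X.V) : ℕ := ∑ i with X.inc v i, c i

/-- Some vertex of `Y` carries the same items as the vertex `v` of `X`. -/
def Shared (X Y : IncidenceSystem ι N c) (v : X.V) : Prop := ∃ x : Y.V, ∀ i, X.inc v i ↔ Y.inc x i

/-- What survives of the equality of all contractions of single edges of `X` and `Y`. -/
structure Matching (X Y : IncidenceSystem ι N c) : Prop where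
  card_eq : Fintype.card X.V = Fintype.card Y.V
  three_le : 3 ≤ Fintype.card X.V
  contract : ∀ e ∈ N, ∀ v, ¬ X.inc v e →
    X.Shared Y v ∨ ∀ i, X.inc v i ↔ i ≠ e ∧ ∃ x, Y.inc x e ∧ Y.inc x i
  contract' : ∀ e ∈ N, ∀ v, ¬ Y.inc v e →
    Y.Shared X v ∨ ∀ i, Y.inc v i ↔ i ≠ e ∧ ∃ x, X.inc x e ∧ X.inc x i
  parallel : ∀ e ∈ N, ∀ f ∈ N, (∀ u, X.inc u e → X.inc u f) → ∀ x, Y.inc x e → Y.inc x f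
  parallel' : ∀ e ∈ N, ∀ f ∈ N, (∀ u, Y.inc u e → Y.inc u f) → ∀ x, X.inc x e → X.inc x f

lemma Matching.symm {X Y : IncidenceSystem ι N c} (h : X.Matching Y) : Y.Matching X :=
  ⟨h.card_eq.symm, h.card_eq ▸ h.three_le, h.contract', h.contract, h.parallel', h.parallel⟩

variable {X Y : IncidenceSystem ι N c}

/-! ### Vertices and their sets of items -/

lemma eq_of_inc_three {e : ι} (he : e ∈ N) {x y z : X.V} (hx : X.inc x e) (hy : X.inc y e)
    (hz : X.inc z e) : x = y ∨ y = z ∨ x = z := by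
  obtain ⟨a, b, -, h⟩ := X.two_ends e he
  rw [h] at hx hy hz
  grind

lemma eq_of_inc_two {i : ι} (hi : i ∉ N) {x y : X.V} (hx : X.inc x i) (hy : X.inc y i) :
    x = y := by
  obtain ⟨a, h⟩ := X.one_end i hi
  rw [h] at hx hy
  exact hx.trans hy.symm

/-- A set of at most two vertices is left by an edge. -/
lemma exists_edge_leaving (h3 : 3 ≤ Fintype.card X.V) (u v : X.V) :
    ∃ e ∈ N, ∃ a b, (a = u ∨ a = v) ∧ b ≠ u ∧ b ≠ v ∧ X.inc a e ∧ X.inc b e := by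
  classical
  have hne : ({u, v} : Set X.V) ≠ Set.univ := by
    intro h
    have h1 : (Finset.univ : Finset X.V) = {u, v} := by
      ext x
      have : x ∈ ({u, v} : Set X.V) := h ▸ Set.mem_univ x
      simpa using this
    have h2 : Fintype.card X.V ≤ 2 := by
      rw [← Finset.card_univ, h1]; exact Finset.card_le_two
    omega
  obtain ⟨e, he, a, ha, b, hb, h⟩ := X.conn {u, v} ⟨u, by simp⟩ hne
  simp only [Set.mem_insert_iff, Set.mem_singleton_iff, not_or] at ha hb
  exact ⟨e, he, a, b, ha, hb.1, hb.2, h⟩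

/-- An edge that leaves `{u, v}` would be incident to both and to a third vertex. -/
lemma eq_of_inc_iff (h3 : 3 ≤ Fintype.card X.V) {u v : X.V}
    (h : ∀ i, X.inc u i ↔ X.inc v i) : u = v := by
  by_contra hne
  obtain ⟨e, he, a, b, ha, hbu, hbv, hae, hbe⟩ := exists_edge_leaving h3 u v
  have hu : X.inc u e := by rcases ha with rfl | rfl; exacts [hae, (h e).2 hae]
  rcases eq_of_inc_three he hu ((h e).1 hu) hbe with h | h | h
  exacts [hne h, hbv h.symm, hbu h.symm]

open scoped Classical in
lemma card_ends (i : ι) : (Finset.univ.filter fun x => X.inc x i).card = if i ∈ N then 2 else 1 := by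
  split_ifs with hi
  · obtain ⟨a, b, hab, h⟩ := X.two_ends i hi
    have : (Finset.univ.filter fun x => X.inc x i) = {a, b} := by ext x; simp [h]
    rw [this, Finset.card_pair hab]
  · obtain ⟨a, h⟩ := X.one_end i hi
    have : (Finset.univ.filter fun x => X.inc x i) = {a} := by ext x; simp [h]
    rw [this, Finset.card_singleton]

/-- The other vertices are matched injectively, so exactly one vertex of `Y` is left over. Since
every item has equally many ends in `X` and in `Y`, the ends not accounted for by the matched
vertices lie at `v` and at the leftover vertex. -/
lemma shared_of_forall_ne (hcard : Fintype.card X.V = Fintype.card Y.V)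
    (h3 : 3 ≤ Fintype.card X.V) {v : X.V} (h : ∀ u, u ≠ v → X.Shared Y u) : X.Shared Y v := by
  classical
  choose f hf using h
  have hinj : ∀ u w (hu : u ≠ v) (hw : w ≠ v), f u hu = f w hw → u = w := fun u w hu hw huw =>
    eq_of_inc_iff h3 fun i => by rw [hf u hu, hf w hw, huw]
  obtain ⟨x, hx⟩ : ∃ x, ∀ u hu, f u hu ≠ x := by
    by_contra! hcon
    choose k hk hk' using hcon
    have hki : Function.Injective k := fun a b hab => by
      rw [← hk' a, ← hk' b]; congr 1
    have : Function.Bijective k :=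
      (Fintype.bijective_iff_injective_and_card k).2 ⟨hki, hcard.symm⟩
    obtain ⟨y, hy⟩ := this.2 v
    exact hk y hy
  let F : X.V → Y.V := fun u => if hu : u = v then x else f u hu
  have hFv : F v = x := dif_pos rfl
  have hF : ∀ u (hu : u ≠ v), F u = f u hu := fun u hu => dif_neg hu
  have hFi : Function.Injective F := by
    intro a b hab
    by_cases ha : a = v <;> by_cases hb : b = v
    · rw [ha, hb]
    · subst ha; rw [hFv, hF b hb] at hab; exact (hx _ _ hab.symm).elim
    · subst hb; rw [hFv, hF a ha] at hab; exact (hx _ _ hab).elim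
    · rw [hF a ha, hF b hb] at hab; exact hinj _ _ _ _ hab
  have hFb : Function.Bijective F :=
    (Fintype.bijective_iff_injective_and_card F).2 ⟨hFi, hcard⟩
  refine ⟨x, fun i => ?_⟩
  let A := Finset.univ.filter fun u => X.inc u i
  let B := Finset.univ.filter fun u => Y.inc (F u) i
  -- Both numbers are two for an edge in `N` and one for any other item.
  have hAB : A.card = B.card := by
    have h1 : B.card = (Finset.univ.filter fun y => Y.inc y i).card :=
      Finset.card_bij (fun u _ => F u) (fun u hu => by simpa [B] using hu)
        (fun a _ b _ h => hFi h) fun y hy => by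
          obtain ⟨u, rfl⟩ := hFb.2 y
          exact ⟨u, by simpa [B] using hy, rfl⟩
    rw [h1, card_ends, card_ends]
  have hE : A.erase v = B.erase v := by
    ext u
    simp only [Finset.mem_erase, A, B, Finset.mem_filter, Finset.mem_univ, true_and]
    refine and_congr_right fun hu => ?_
    rw [hf u hu, hF u hu]
  have key : v ∈ A ↔ v ∈ B := by
    have hc := congrArg Finset.card hE
    rw [Finset.card_erase_eq_ite, Finset.card_erase_eq_ite] at hc
    have hA : v ∈ A → 0 < A.card := fun h => Finset.card_pos.2 ⟨v, h⟩
    have hB : v ∈ B → 0 < B.card := fun h => Finset.card_pos.2 ⟨v, h⟩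
    by_cases h1 : v ∈ A <;> by_cases h2 : v ∈ B <;> simp only [h1, h2, if_true, if_false] at hc ⊢
    · have := hA h1; omega
    · have := hB h2; omega
  simpa [A, B, hFv] using key

/-! ### Reconstruction by induction on the degree -/

/-- The multiplicities at the two ends of an edge without parallels are below that of the vertex
into which the edge is contracted. -/
lemma deg_lt_of_contract (hc : ∀ e ∈ N, c e = 1) {e : ι} (he : e ∈ N) {v : X.V} {a b : Y.V}
    (hb : Y.inc b e)
    (hv : ∀ i, X.inc v i ↔ i ≠ e ∧ (Y.inc a i ∨ Y.inc b i))
    (hpar : ∀ i, Y.inc a i → Y.inc b i → i = e) (ha : Y.inc a e) : Y.deg a < X.deg v := by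
  classical
  have h1 : X.deg v = ∑ i ∈ (Finset.univ.filter fun i => Y.inc a i).erase e, c i
      + ∑ i ∈ (Finset.univ.filter fun i => Y.inc b i).erase e, c i := by
    rw [deg, ← Finset.sum_union]
    · refine Finset.sum_congr ?_ fun _ _ => rfl
      ext i
      simp only [Finset.mem_filter, Finset.mem_univ, true_and, Finset.mem_union, Finset.mem_erase]
      rw [hv i]
      tauto
    · rw [Finset.disjoint_left]
      intro i hi hi'
      simp only [Finset.mem_filter, Finset.mem_univ, true_and, Finset.mem_erase] at hi hi'
      exact hi.1 (hpar i hi.2 hi'.2)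
  have h2 := Finset.add_sum_erase (Finset.univ.filter fun i => Y.inc a i) c (a := e) (by simpa)
  have h3 := Finset.add_sum_erase (Finset.univ.filter fun i => Y.inc b i) c (a := e) (by simpa)
  have h4 := Y.stable b
  rw [deg, h1]
  rw [hc e he] at h2 h3
  have : 3 ≤ ∑ i ∈ (Finset.univ.filter fun i => Y.inc b i), c i := by convert h4
  -- The degree of `v` is `(deg a - 1) + (deg b - 1)`, and `deg b ≥ 3`.
  omega

/-- If `q` in `X` had the items of `b`, then `q ≠ v`, because `e` is at `q` and not at `v`. A loop
or marking at `b` would sit at both `q` and `v`. An edge at `b` is also at `a`, so it is `e`. Hence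
`e` is the only item at `b`, against stability. -/
lemma shared_of_center {a b : Y.V} {v : X.V} (hc : ∀ e ∈ N, c e = 1) {e : ι} (he : e ∈ N)
    (ha : Y.inc a e) (hb : Y.inc b e)
    (hv : ∀ i, X.inc v i ↔ i ≠ e ∧ (Y.inc a i ∨ Y.inc b i))
    (hpar : ∀ i, Y.inc a i → Y.inc b i → i = e) (hcen : ∀ f ∈ N, Y.inc a f) :
    ¬ Y.Shared X b := by
  classical
  rintro ⟨q, hq⟩
  have hve : ¬ X.inc v e := fun h => ((hv e).1 h).1 rfl
  have hqv : q ≠ v := fun h => hve (h ▸ (hq e).1 hb)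
  have hN : ∀ i, Y.inc b i → i ∉ N → False := fun i hi hiN => by
    refine hqv (eq_of_inc_two hiN ((hq i).1 hi) ((hv i).2 ⟨?_, Or.inr hi⟩))
    rintro rfl; exact hiN he
  have h1 : (Finset.univ.filter fun i => Y.inc b i) = {e} := by
    ext i
    simp only [Finset.mem_filter, Finset.mem_univ, true_and, Finset.mem_singleton]
    refine ⟨fun hi => ?_, fun h => h ▸ hb⟩
    by_cases hiN : i ∈ N
    · exact hpar i (hcen i hiN) hi
    · exact (hN i hi hiN).elim
  have h2 := Y.stable b
  have h3 : 3 ≤ ∑ i ∈ (Finset.univ.filter fun i => Y.inc b i), c i := by convert h2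
  rw [h1, Finset.sum_singleton, hc e he] at h3
  omega

/-- A vertex that some edge avoids is shared. -/
lemma Matching.shared_of_edge (hc : ∀ e ∈ N, c e = 1) (d : ℕ) :
    ∀ X Y : IncidenceSystem ι N c, X.Matching Y → ∀ v : X.V, X.deg v = d →
      ∀ e ∈ N, ¬ X.inc v e → X.Shared Y v := by
  -- The statement quantifies over both systems because the induction step exchanges their roles: it
  -- applies to the ends `a`, `b` of `e` in `Y`.
  induction d using Nat.strong_induction_on with
  | _ d ih =>
    intro X Y h v hd e he hve
    rcases h.contract e he v hve with hs | hv
    · exact hs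
    obtain ⟨a, b, hab, hends⟩ := Y.two_ends e he
    have ha : Y.inc a e := (hends a).2 (Or.inl rfl)
    have hb : Y.inc b e := (hends b).2 (Or.inr rfl)
    replace hv : ∀ i, X.inc v i ↔ i ≠ e ∧ (Y.inc a i ∨ Y.inc b i) := fun i => by
      rw [hv i]
      refine and_congr_right fun _ => ⟨?_, ?_⟩
      · rintro ⟨x, hx, hxi⟩
        rcases (hends x).1 hx with rfl | rfl
        exacts [Or.inl hxi, Or.inr hxi]
      · rintro (hi | hi)
        exacts [⟨a, ha, hi⟩, ⟨b, hb, hi⟩]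
    -- A second edge between `a` and `b` would be parallel to `e` in `Y`, hence in `X`. It is an
    -- item of `v`, so `e` would be one too.
    have hpar : ∀ i, Y.inc a i → Y.inc b i → i = e := fun i hai hbi => by
      by_contra hne
      by_cases hiN : i ∈ N
      · refine hve (h.parallel' i hiN e he (fun u hu => ?_) v ((hv i).2 ⟨hne, Or.inl hai⟩))
        rcases eq_of_inc_three hiN hu hai hbi with rfl | h | rfl
        exacts [ha, (hab h).elim, hb]
      · exact hab (eq_of_inc_two hiN hai hbi)
    have hv' : ∀ i, X.inc v i ↔ i ≠ e ∧ (Y.inc b i ∨ Y.inc a i) := fun i => by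
      rw [hv i, or_comm]
    have hpar' : ∀ i, Y.inc b i → Y.inc a i → i = e := fun i h h' => hpar i h' h
    have h3 := h.three_le
    have h3' := h.symm.three_le
    have hda := deg_lt_of_contract hc he hb hv hpar ha
    have hdb := deg_lt_of_contract hc he ha hv' hpar' hb
    -- A vertex of smaller degree is shared by induction, unless no edge avoids it.
    have alt : ∀ x : Y.V, Y.deg x < X.deg v → Y.Shared X x ∨ ∀ f ∈ N, Y.inc x f := fun x hx => by
      by_contra! hcon
      obtain ⟨hs, f, hf, hxf⟩ := hcon
      exact hs (ih _ (hd ▸ hx) Y X h.symm x rfl f hf hxf)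
    rcases alt a hda with hsa | hca <;> rcases alt b hdb with hsb | hcb
    · obtain ⟨p, hp⟩ := hsa
      obtain ⟨q, hq⟩ := hsb
      refine shared_of_forall_ne h.card_eq h3 fun u hu => ?_
      -- No edge leaves `{v, p, q}`: `e` joins `p` and `q`, and every other edge at one of the three
      -- joins `v` to `p` or `q`. By connectedness these are all the vertices of `X`, and all except
      -- `v` are shared.
      have hup : u = p ∨ u = q := by
        by_contra! hcon
        have hpv : p ≠ v := by rintro rfl; exact hve ((hp e).1 ha)
        have hqv : q ≠ v := by rintro rfl; exact hve ((hq e).1 hb)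
        have hpq : p ≠ q := by
          rintro rfl
          exact hab (eq_of_inc_iff h3' fun i => (hp i).trans (hq i).symm)
        obtain ⟨f, hf, x, hx, y, hy, hxf, hyf⟩ := X.conn {v, p, q} ⟨v, by simp⟩ (by
          intro hU
          have : u ∈ ({v, p, q} : Set X.V) := hU ▸ Set.mem_univ u
          simp only [Set.mem_insert_iff, Set.mem_singleton_iff] at this
          tauto)
        simp only [Set.mem_insert_iff, Set.mem_singleton_iff, not_or] at hx hy
        obtain ⟨hyv, hyp, hyq⟩ := hy
        have hfv : X.inc v f → X.inc p f ∨ X.inc q f := fun h => by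
          rw [← hp, ← hq]; exact ((hv f).1 h).2
        have hfe : f ≠ e := by
          rintro rfl
          rcases eq_of_inc_three hf ((hp f).1 ha) ((hq f).1 hb) hyf with h | h | h
          exacts [hpq h, hyq h.symm, hyp h.symm]
        have hpf : X.inc p f → X.inc v f := fun h => (hv f).2 ⟨hfe, Or.inl ((hp f).2 h)⟩
        have hqf : X.inc q f → X.inc v f := fun h => (hv f).2 ⟨hfe, Or.inr ((hq f).2 h)⟩
        have hvf : X.inc v f := by
          rcases hx with rfl | rfl | rfl
          exacts [hxf, hpf hxf, hqf hxf]
        rcases hfv hvf with h' | h'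
        · rcases eq_of_inc_three hf hvf h' hyf with h | h | h
          exacts [hpv h.symm, hyp h.symm, hyv h.symm]
        · rcases eq_of_inc_three hf hvf h' hyf with h | h | h
          exacts [hqv h.symm, hyq h.symm, hyv h.symm]
      rcases hup with rfl | rfl
      exacts [⟨a, fun i => (hp i).symm⟩, ⟨b, fun i => (hq i).symm⟩]
    · exact (shared_of_center hc he hb ha hv' hpar' hcb ⟨_, hsa.choose_spec⟩).elim
    · exact (shared_of_center hc he ha hb hv hpar hca ⟨_, hsb.choose_spec⟩).elim
    -- All edges would join `a` and `b`, but some edge reaches a third vertex.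
    · obtain ⟨f, hf, x, y, -, hya, hyb, -, hyf⟩ := exists_edge_leaving h3' a b
      rcases eq_of_inc_three hf (hca f hf) (hcb f hf) hyf with h | h | h
      exacts [(hab h).elim, (hyb h.symm).elim, (hya h.symm).elim]

/-- One vertex alone cannot fail to be shared, and vertices that fail meet every edge. Two of them
are excluded by an edge to a third vertex. -/
lemma Matching.shared (hc : ∀ e ∈ N, c e = 1) (h : X.Matching Y) (v : X.V) : X.Shared Y v := by
  by_contra hs
  refine hs (shared_of_forall_ne h.card_eq h.three_le fun u hu => ?_)
  by_contra hsu
  obtain ⟨f, hf, x, y, -, hya, hyb, -, hyf⟩ := exists_edge_leaving h.three_le u v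
  have hcen : ∀ w, ¬ X.Shared Y w → X.inc w f := fun w hw => by
    by_contra hwf
    exact hw (h.shared_of_edge hc _ _ _ w rfl f hf hwf)
  rcases eq_of_inc_three hf (hcen u hsu) (hcen v hs) hyf with h | h | h
  exacts [hu h, hyb h.symm, hya h.symm]

/-- An incidence system with at least three vertices is determined by the contractions of its
edges. -/
theorem Matching.exists_equiv (hc : ∀ e ∈ N, c e = 1) (h : X.Matching Y) :
    ∃ φ : X.V ≃ Y.V, ∀ v i, X.inc v i ↔ Y.inc (φ v) i := by
  choose f hf using h.shared hc
  have hinj : Function.Injective f := fun u v huv =>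
    eq_of_inc_iff h.three_le fun i => by rw [hf, hf, huv]
  exact ⟨Equiv.ofBijective f
    ((Fintype.bijective_iff_injective_and_card f).2 ⟨hinj, h.card_eq⟩), hf⟩

end IncidenceSystem

/-! ## Labelled graphs and their faces -/

namespace LabelledGraph

variable {g n k : ℕ}

/-- The vertex `v` is an end of the edge with label `l`. -/
def inc (A : LabelledGraph g n k) (v : A.graph.V) (l : Fin k) : Prop :=
  ∃ h, A.lab h = l ∧ A.graph.r h = v

/-- The edge with label `l` is a loop. -/
def IsLoop (A : LabelledGraph g n k) (l : Fin k) : Prop :=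
  ∀ h, A.lab h = l → A.graph.r (A.graph.s h) = A.graph.r h

lemma card_edges (A : LabelledGraph g n k) : Fintype.card A.graph.E = k := by
  rw [Fintype.card_congr A.label, Fintype.card_fin]

lemma genus_eq (A : LabelledGraph g n k) :
    k + 1 + ∑ v, A.graph.w v = g + Fintype.card A.graph.V := by
  have h := A.graph.genus
  rw [HGraph.betti, A.card_edges] at h
  have : ((k + 1 + ∑ v, A.graph.w v : ℕ) : ℤ) = (g + Fintype.card A.graph.V : ℕ) := by
    push_cast; linarith
  exact_mod_cast this

lemma card_pos (A : LabelledGraph g n k) : 0 < Fintype.card A.graph.V :=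
  Fintype.card_pos_iff.2 A.graph.connected.1

lemma inc_lab (A : LabelledGraph g n k) (h : A.graph.H) : A.inc (A.graph.r h) (A.lab h) :=
  ⟨h, rfl, rfl⟩

lemma inc_iff (A : LabelledGraph g n k) (h : A.graph.H) (v : A.graph.V) :
    A.inc v (A.lab h) ↔ v = A.graph.r h ∨ v = A.graph.r (A.graph.s h) := by
  constructor
  · rintro ⟨h', hl, rfl⟩
    rcases A.lab_eq_iff.1 hl.symm with rfl | rfl
    exacts [Or.inl rfl, Or.inr rfl]
  · rintro (rfl | rfl)
    exacts [⟨h, rfl, rfl⟩, ⟨_, A.lab_s h, rfl⟩]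

lemma isLoop_iff (A : LabelledGraph g n k) (h : A.graph.H) :
    A.IsLoop (A.lab h) ↔ A.graph.r (A.graph.s h) = A.graph.r h := by
  refine ⟨fun H => H h rfl, fun H h' hl => ?_⟩
  rcases A.lab_eq_iff.1 hl.symm with rfl | rfl
  · exact H
  · rw [A.graph.s_s, H]

lemma IsLoop.eq_of_inc {A : LabelledGraph g n k} {l : Fin k} (hl : A.IsLoop l) {u v : A.graph.V}
    (hu : A.inc u l) (hv : A.inc v l) : u = v := by
  obtain ⟨h, rfl, rfl⟩ := hu
  rw [inc_iff, hl h rfl, or_self] at hv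
  exact hv.symm

lemma joined_induction {j : ℕ} {A : LabelledGraph g n k} {P : A.graph.V → A.graph.V → Prop}
    (hP : Equivalence P) (ι : Fin j ↪ Fin k)
    (hs : ∀ l ∉ Set.range ι, ∀ u v, A.inc u l → A.inc v l → P u v)
    {u v : A.graph.V} (huv : A.graph.joined (A.missed ι) u v) : P u v :=
  joined_missed_mono hP ι
    (fun h hh => hs _ hh _ _ (A.inc_lab h) ((A.inc_iff h _).2 (Or.inr rfl))) huv

lemma joined_of_inc {j : ℕ} {A : LabelledGraph g n k} (ι : Fin j ↪ Fin k) {l : Fin k}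
    (hl : l ∉ Set.range ι) {u v : A.graph.V} (hu : A.inc u l) (hv : A.inc v l) :
    A.graph.joined (A.missed ι) u v := by
  obtain ⟨h, rfl, rfl⟩ := hu
  rcases (A.inc_iff h v).1 hv with rfl | rfl
  · exact Setoid.refl' _ _
  · exact joined_edge ι hl

/-- Connectedness, as an induction principle. -/
lemma rel_of_forall_inc {A : LabelledGraph g n k} {P : A.graph.V → A.graph.V → Prop}
    (hP : Equivalence P) (hs : ∀ l u v, A.inc u l → A.inc v l → P u v) (u v : A.graph.V) :
    P u v := by
  have huv := A.graph.connected.2 u v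
  induction huv with
  | rel u v h =>
    obtain ⟨h, -, rfl, rfl⟩ := h
    exact hs _ _ _ (A.inc_lab h) ((A.inc_iff h _).2 (Or.inr rfl))
  | refl u => exact hP.refl u
  | symm u v _ ih => exact hP.symm ih
  | trans u v w _ _ ih1 ih2 => exact hP.trans ih1 ih2

lemma exists_not_isLoop {A : LabelledGraph g n k} (h : 2 ≤ Fintype.card A.graph.V) :
    ∃ l, ¬ A.IsLoop l := by
  by_contra! hcon
  have : Subsingleton A.graph.V := ⟨rel_of_forall_inc ⟨fun _ => rfl, Eq.symm, Eq.trans⟩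
    fun l u v hu hv => (hcon l).eq_of_inc hu hv⟩
  have := Fintype.card_le_one_iff_subsingleton.2 this
  omega

lemma face_inc_iff {j : ℕ} {A : LabelledGraph g n k} (ι : Fin j ↪ Fin k) (v : A.graph.V)
    (l : Fin j) : (A.face ι).inc (A.graph.comp (A.missed ι) v) l ↔
      ∃ u, A.graph.joined (A.missed ι) u v ∧ A.inc u (ι l) := by
  constructor
  · rintro ⟨h, rfl, hr⟩
    exact ⟨A.graph.r h.1, HGraph.comp_eq_iff.1 hr, h.1, (A.face_lab ι h).symm, rfl⟩
  · rintro ⟨u, hu, h, hl, rfl⟩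
    exact ⟨⟨h, fun hh => hh ⟨l, hl.symm⟩⟩, ι.injective ((face_lab ι A _).trans hl),
      HGraph.comp_eq_iff.2 hu⟩

lemma face_isLoop_iff {j : ℕ} {A : LabelledGraph g n k} (ι : Fin j ↪ Fin k) (l : Fin j) :
    (A.face ι).IsLoop l ↔
      ∀ u v, A.inc u (ι l) → A.inc v (ι l) → A.graph.joined (A.missed ι) u v := by
  constructor
  · intro h u v hu hv
    exact HGraph.comp_eq_iff.1 (h.eq_of_inc ((face_inc_iff ι u l).2 ⟨u, Setoid.refl' _ _, hu⟩)
      ((face_inc_iff ι v l).2 ⟨v, Setoid.refl' _ _, hv⟩))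
  · rintro H h rfl
    refine HGraph.comp_eq_iff.2 (H _ _ ?_ ?_)
    · rw [face_lab, inc_iff]; exact Or.inr rfl
    · rw [face_lab, inc_iff]; exact Or.inl rfl

/-- Contracting an edge removes at most one vertex. -/
lemma card_le_card_face {j : ℕ} (A : LabelledGraph g n k) (ι : Fin j ↪ Fin k) :
    Fintype.card A.graph.V + j ≤ Fintype.card (A.face ι).graph.V + k := by
  classical
  let S := A.missed ι
  have h1 : Fintype.card A.graph.V = ∑ c, (A.graph.compVerts S c).card := by
    rw [← Finset.card_univ, Finset.card_eq_sum_card_fiberwise (f := A.graph.comp S)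
      (t := Finset.univ) (fun _ _ => Finset.mem_coe.2 (Finset.mem_univ _))]
    refine Finset.sum_congr rfl fun c _ => congrArg Finset.card ?_
    ext v
    simp [HGraph.compVerts]
  have h2 : ∑ c, (A.graph.compVerts S c).card ≤ ∑ c, ((A.graph.compEdges S c).card + 1) :=
    Finset.sum_le_sum fun c _ => HGraph.card_compVerts_le S c
  rw [Finset.sum_add_distrib, HGraph.sum_card_compEdges] at h2
  simp only [Finset.sum_const, Finset.card_univ, smul_eq_mul, mul_one] at h2
  have h3 : (Finset.univ.filter fun e => e ∈ S).card + j = k := by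
    have h4 := Finset.card_filter_add_card_filter_not (s := Finset.univ) (fun e => e ∈ S)
    rw [Finset.card_univ, A.card_edges] at h4
    have h5 : (Finset.univ.filter fun e => e ∉ S).card = j := by
      rw [← Fintype.card_subtype, ← Fintype.card_congr (HGraph.contractEdge S)]
      exact (A.face ι).card_edges
    omega
  have h6 : Fintype.card (A.face ι).graph.V = Fintype.card (A.graph.Comp S) :=
    Fintype.card_congr (Equiv.refl _)
  omega

lemma notMem_range_succAboveEmb (e l : Fin (k + 1)) : l ∉ Set.range (Fin.succAboveEmb e) ↔ l = e := by
  simp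

lemma joined_succAbove_iff {A : LabelledGraph g n (k + 1)} (e : Fin (k + 1)) {u v : A.graph.V} :
    A.graph.joined (A.missed (Fin.succAboveEmb e)) u v ↔ u = v ∨ A.inc u e ∧ A.inc v e := by
  constructor
  · refine joined_induction (P := fun u v => u = v ∨ A.inc u e ∧ A.inc v e)
      ⟨fun _ => Or.inl rfl, ?_, ?_⟩ _ ?_
    · rintro _ _ (rfl | ⟨h, h'⟩)
      exacts [Or.inl rfl, Or.inr ⟨h', h⟩]
    · rintro _ _ _ (rfl | ⟨h, h'⟩) (rfl | ⟨h1, h2⟩)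
      exacts [Or.inl rfl, Or.inr ⟨h1, h2⟩, Or.inr ⟨h, h'⟩, Or.inr ⟨h, h2⟩]
    · intro l hl u v hu hv
      rw [notMem_range_succAboveEmb] at hl
      subst hl
      exact Or.inr ⟨hu, hv⟩
  · rintro (rfl | ⟨hu, hv⟩)
    · exact Setoid.refl' _ _
    · exact joined_of_inc _ ((notMem_range_succAboveEmb e e).2 rfl) hu hv

lemma card_face_of_isLoop {A : LabelledGraph g n (k + 1)} {e : Fin (k + 1)} (he : A.IsLoop e) :
    Fintype.card (A.face (Fin.succAboveEmb e)).graph.V = Fintype.card A.graph.V := by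
  refine (Fintype.card_of_bijective (f := A.graph.comp (A.missed (Fin.succAboveEmb e)))
    ⟨fun u v huv => ?_, HGraph.comp_surj _⟩).symm
  rcases (joined_succAbove_iff e).1 (HGraph.comp_eq_iff.1 huv) with h | ⟨h, h'⟩
  exacts [h, he.eq_of_inc h h']

lemma card_face_of_not_isLoop {A : LabelledGraph g n (k + 1)} {e : Fin (k + 1)}
    (he : ¬ A.IsLoop e) :
    Fintype.card (A.face (Fin.succAboveEmb e)).graph.V + 1 = Fintype.card A.graph.V := by
  have h1 := A.card_le_card_face (Fin.succAboveEmb e)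
  have h2 : Fintype.card (A.face (Fin.succAboveEmb e)).graph.V < Fintype.card A.graph.V := by
    refine Fintype.card_lt_of_surjective_not_injective
      (A.graph.comp (A.missed (Fin.succAboveEmb e))) (HGraph.comp_surj _) fun hinj => he ?_
    rintro h rfl
    refine hinj (HGraph.comp_eq_iff.2 ((joined_succAbove_iff _).2 (Or.inr ⟨?_, ?_⟩)))
    · rw [inc_iff]; exact Or.inr rfl
    · exact A.inc_lab h
  omega

/-! ### Isomorphisms -/

/-- A bijection on vertices that respects weights, markings and the ends of every edge comes from
an isomorphism. -/
lemma nonempty_iso_of_equiv {A B : LabelledGraph g n k} (φ : A.graph.V ≃ B.graph.V)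
    (hw : ∀ v, B.graph.w (φ v) = A.graph.w v) (hm : ∀ i, φ (A.graph.m i) = B.graph.m i)
    (he : ∀ l, ∃ h h', A.lab h = l ∧ B.lab h' = l ∧ φ (A.graph.r h) = B.graph.r h' ∧
      φ (A.graph.r (A.graph.s h)) = B.graph.r (B.graph.s h')) : Nonempty (Iso A B) := by
  classical
  -- The half-edges `p l` and `q l` orient the edge `l` compatibly in both graphs; the bijection of
  -- half-edges sends `p l` to `q l` and hence the opposite half to the opposite half.
  choose p q hp hq hr hrs using he
  have hpc : ∀ h, h = p (A.lab h) ∨ h = A.graph.s (p (A.lab h)) := fun h =>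
    A.lab_eq_iff.1 (hp (A.lab h))
  have hqc : ∀ h, h = q (B.lab h) ∨ h = B.graph.s (q (B.lab h)) := fun h =>
    B.lab_eq_iff.1 (hq (B.lab h))
  let F : A.graph.H → B.graph.H := fun h =>
    if h = p (A.lab h) then q (A.lab h) else B.graph.s (q (A.lab h))
  let F' : B.graph.H → A.graph.H := fun h =>
    if h = q (B.lab h) then p (B.lab h) else A.graph.s (p (B.lab h))
  have hF : ∀ l, F (p l) = q l := fun l => by simp [F, hp]
  have hFs : ∀ l, F (A.graph.s (p l)) = B.graph.s (q l) := fun l => by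
    simp [F, A.lab_s, hp, A.graph.s_ne]
  have hF' : ∀ l, F' (q l) = p l := fun l => by simp [F', hq]
  have hFs' : ∀ l, F' (B.graph.s (q l)) = A.graph.s (p l) := fun l => by
    simp [F', B.lab_s, hq, B.graph.s_ne]
  have hcases : ∀ {P : A.graph.H → Prop}, (∀ l, P (p l)) → (∀ l, P (A.graph.s (p l))) →
      ∀ h, P h := fun h1 h2 h => by
    rcases hpc h with e | e
    · rw [e]; exact h1 _
    · rw [e]; exact h2 _
  refine ⟨⟨φ, ⟨F, F', ?_, ?_⟩, ?_, ?_, hw, hm, ?_⟩⟩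
  · exact hcases (fun l => by rw [hF, hF']) (fun l => by rw [hFs, hFs'])
  · intro h
    rcases hqc h with e | e
    · rw [e, hF', hF]
    · rw [e, hFs', hFs]
  · exact hcases (fun l => by simp [hF, hr]) (fun l => by simp [hFs, hrs])
  · exact hcases (fun l => by simp [hF, hFs]) (fun l => by simp [hF, hFs, A.graph.s_s, B.graph.s_s])
  · exact hcases (fun l => by simp [hF, hp, hq]) (fun l => by simp [hFs, lab_s, hp, hq])

/-- On one vertex all edges are loops and all markings coincide, and the genus formula determines
the weight. So there is exactly one rose for a given number of edges. -/
lemma nonempty_iso_of_card_one {A B : LabelledGraph g n k} (hA : Fintype.card A.graph.V = 1)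
    (hB : Fintype.card B.graph.V = 1) : Nonempty (Iso A B) := by
  have := Fintype.card_le_one_iff_subsingleton.1 hB.le
  let φ := Fintype.equivOfCardEq (hA.trans hB.symm)
  have hw : ∑ v, B.graph.w (φ v) = ∑ v, A.graph.w v := by
    rw [Equiv.sum_comp φ B.graph.w]
    have h1 := A.genus_eq
    have h2 := B.genus_eq
    omega
  obtain ⟨v0, hv0⟩ := Fintype.card_eq_one_iff.1 hA
  have huniv : (Finset.univ : Finset A.graph.V) = {v0} := by
    ext v; simp [hv0 v]
  rw [huniv, Finset.sum_singleton, Finset.sum_singleton] at hw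
  refine nonempty_iso_of_equiv φ (fun v => by rw [hv0 v, hw]) (fun i => Subsingleton.elim _ _)
    fun l => ?_
  obtain ⟨h, hh⟩ := A.lab_surj l
  obtain ⟨h', hh'⟩ := B.lab_surj l
  exact ⟨h, h', hh, hh', Subsingleton.elim _ _, Subsingleton.elim _ _⟩

lemma Iso.inc_iff {A B : LabelledGraph g n k} (φ : Iso A B) (v : A.graph.V) (l : Fin k) :
    B.inc (φ.onV v) l ↔ A.inc v l := by
  constructor
  · rintro ⟨h, rfl, hr⟩
    obtain ⟨h, rfl⟩ := φ.onH.surjective h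
    rw [← φ.map_r, φ.onV.injective.eq_iff] at hr
    exact ⟨h, (φ.map_lab h).symm, hr⟩
  · rintro ⟨h, rfl, rfl⟩
    exact ⟨φ.onH h, φ.map_lab h, (φ.map_r h).symm⟩

lemma Iso.isLoop_iff {A B : LabelledGraph g n k} (φ : Iso A B) (l : Fin k) :
    B.IsLoop l ↔ A.IsLoop l := by
  obtain ⟨h, rfl⟩ := A.lab_surj l
  rw [A.isLoop_iff, ← φ.map_lab, B.isLoop_iff, ← φ.map_s, ← φ.map_r, ← φ.map_r,
    φ.onV.injective.eq_iff]

end LabelledGraph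

/-! ## Simplices -/

namespace TropSimplex

variable {g n : ℕ}

/-- The isomorphism class of an edge-labelled pair. -/
def mk {k : ℕ} (A : LabelledGraph g n k) : TropSimplex g n k :=
  Quotient.mk (LabelledGraph.isoSetoid g n k) A

lemma mk_surj {k : ℕ} (x : TropSimplex g n k) : ∃ A, mk A = x :=
  Quotient.exists_rep (s := LabelledGraph.isoSetoid g n k) x

lemma mk_eq_iff {k : ℕ} {A B : LabelledGraph g n k} :
    mk A = mk B ↔ Nonempty (LabelledGraph.Iso A B) :=
  Quotient.eq (r := LabelledGraph.isoSetoid g n k)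

lemma face_mk {j k : ℕ} (ι : Fin j ↪ Fin k) (A : LabelledGraph g n k) :
    (mk A).face ι = mk (A.face ι) := rfl

lemma numVertices_mk {k : ℕ} (A : LabelledGraph g n k) :
    (mk A).numVertices = Fintype.card A.graph.V := rfl

lemma face_refl {k : ℕ} (x : TropSimplex g n k) : x.face (Function.Embedding.refl _) = x := by
  obtain ⟨A, rfl⟩ := mk_surj x
  exact mk_eq_iff.2 (LabelledGraph.face_refl A)

lemma face_face {i j k : ℕ} (κ : Fin i ↪ Fin j) (ι : Fin j ↪ Fin k) (x : TropSimplex g n k) :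
    (x.face ι).face κ = x.face (κ.trans ι) := by
  obtain ⟨A, rfl⟩ := mk_surj x
  exact (mk_eq_iff.2 (LabelledGraph.face_face κ ι A)).symm

lemma numVertices_pos {k : ℕ} (x : TropSimplex g n k) : 0 < x.numVertices := by
  obtain ⟨A, rfl⟩ := mk_surj x
  exact A.card_pos

/-- The difference of the two sides is the total weight. Equality is how weightlessness is expressed
for simplices below. -/
lemma le_genus {k : ℕ} (x : TropSimplex g n k) : k + 1 ≤ g + x.numVertices := by
  obtain ⟨A, rfl⟩ := mk_surj x
  have := A.genus_eq
  rw [numVertices_mk]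
  omega

lemma numVertices_le_face {j k : ℕ} (ι : Fin j ↪ Fin k) (x : TropSimplex g n k) :
    x.numVertices + j ≤ (x.face ι).numVertices + k := by
  obtain ⟨A, rfl⟩ := mk_surj x
  exact A.card_le_card_face ι

lemma eq_of_numVertices_eq_one {k : ℕ} {x y : TropSimplex g n k} (hx : x.numVertices = 1)
    (hy : y.numVertices = 1) : x = y := by
  obtain ⟨A, rfl⟩ := mk_surj x
  obtain ⟨B, rfl⟩ := mk_surj y
  exact mk_eq_iff.2 (LabelledGraph.nonempty_iso_of_card_one hx hy)

/-- Contracting a spanning tree. -/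
lemma exists_face_numVertices_eq_one (N : ℕ) : ∀ {k : ℕ} (x : TropSimplex g n k),
    x.numVertices = N + 1 → ∃ (j : ℕ) (ι : Fin j ↪ Fin k), j + N = k ∧
      (x.face ι).numVertices = 1 := by
  induction N with
  | zero => intro k x hx; exact ⟨k, Function.Embedding.refl _, rfl, by rw [face_refl, hx]⟩
  | succ N ih =>
    intro k x hx
    obtain ⟨A, rfl⟩ := mk_surj x
    rw [numVertices_mk] at hx
    obtain ⟨l, hl⟩ := A.exists_not_isLoop (by omega)
    obtain ⟨k, rfl⟩ : ∃ k', k = k' + 1 := ⟨k - 1, by have := l.pos; omega⟩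
    have h1 := LabelledGraph.card_face_of_not_isLoop hl
    obtain ⟨j, ι, hj, hι⟩ := ih (mk (A.face (Fin.succAboveEmb l))) (by rw [numVertices_mk]; omega)
    refine ⟨j, ι.trans (Fin.succAboveEmb l), by omega, ?_⟩
    rw [← face_face]
    exact hι

end TropSimplex

/-! ## Construction of labelled graphs -/

/-- The labelling of edges that is given on half-edges by `lab`. -/
noncomputable def HGraph.labelEquiv (G : HGraph) {k : ℕ} (lab : G.H → Fin k)
    (surj : Function.Surjective lab) (lab_eq : ∀ h h', lab h = lab h' ↔ h' = h ∨ h' = G.s h) :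
    G.E ≃ Fin k :=
  Equiv.ofBijective (Quotient.lift (s := G.edgeSetoid) lab fun h h' hh => (lab_eq h h').2 hh) (by
    constructor
    · intro a b
      obtain ⟨h, rfl⟩ := HGraph.edge_surj a
      obtain ⟨h', rfl⟩ := HGraph.edge_surj b
      exact fun hh => HGraph.edge_eq_iff.2 ((lab_eq h h').1 hh)
    · intro l
      obtain ⟨h, rfl⟩ := surj l
      exact ⟨G.edge h, rfl⟩)

open scoped Classical in
lemma HGraph.val_eq_sum (G : HGraph) (v : G.V) : G.val v = ∑ h, if G.r h = v then 1 else 0 := by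
  unfold HGraph.val
  exact Finset.card_filter _ _

namespace LabelledGraph

variable {g n k : ℕ}

/-- An edge-labelled pair from a labelling on half-edges. -/
noncomputable def ofLab (G : HGraph) (lab : G.H → Fin k) (surj : Function.Surjective lab)
    (lab_eq : ∀ h h', lab h = lab h' ↔ h' = h ∨ h' = G.s h) (connected : G.Connected)
    (w : G.V → ℕ) (m : Fin n → G.V) (genus : k + 1 + ∑ v, w v = g + Fintype.card G.V)
    (stable : ∀ v, 2 < 2 * w v + G.val v + Nat.card {i : Fin n // m i = v}) :
    LabelledGraph g n k where
  graph :=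
    { toHGraph := G
      connected := connected
      w := w
      m := m
      genus := by
        have h : ((k + 1 + ∑ v, w v : ℕ) : ℤ) = (g + Fintype.card G.V : ℕ) := by rw [genus]
        push_cast at h
        rw [HGraph.betti, Fintype.card_congr (G.labelEquiv lab surj lab_eq), Fintype.card_fin]
        linarith
      stable := fun v => by
        have := stable v
        omega }
  label := G.labelEquiv lab surj lab_eq

lemma stable' (A : LabelledGraph g n k) (v : A.graph.V) :
    2 < 2 * A.graph.w v + A.graph.val v + Nat.card {i : Fin n // A.graph.m i = v} := by
  have := A.graph.stable v
  omega

/-! ### Adding a loop -/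

/-- The graph `A` with a new loop at `v`. -/
def loopGraph (A : LabelledGraph g n k) (v : A.graph.V) : HGraph where
  V := A.graph.V
  H := A.graph.H ⊕ Bool
  r := Sum.elim A.graph.r fun _ => v
  s := Sum.map A.graph.s not
  s_s := by rintro (h | b) <;> simp [A.graph.s_s]
  s_ne := by rintro (h | b) <;> simp [A.graph.s_ne]

open scoped Classical in
lemma loopGraph_val (A : LabelledGraph g n k) (v u : A.graph.V) :
    (A.loopGraph v).val u = A.graph.val u + if u = v then 2 else 0 := by
  have h1 : (A.loopGraph v).val u
      = ∑ h : A.graph.H ⊕ Bool, if Sum.elim A.graph.r (fun _ => v) h = u then 1 else 0 :=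
    HGraph.val_eq_sum _ _
  rw [h1, Fintype.sum_sum_type, HGraph.val_eq_sum]
  congr 1
  by_cases h : u = v
  · simp [h]
  · simp [h, Ne.symm h]

open scoped Classical in
/-- The weights after one unit of weight at `v` is removed. -/
noncomputable def loopWeight (A : LabelledGraph g n k) (v u : A.graph.V) : ℕ :=
  A.graph.w u - if u = v then 1 else 0

lemma sum_loopWeight (A : LabelledGraph g n k) (v : A.graph.V) (hv : 0 < A.graph.w v) :
    ∑ u, A.loopWeight v u + 1 = ∑ u, A.graph.w u := by
  classical
  have : ∀ u, A.graph.w u = A.loopWeight v u + if u = v then 1 else 0 := by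
    intro u
    unfold loopWeight
    split_ifs with hu
    · subst hu; omega
    · rfl
  rw [Finset.sum_congr rfl fun u _ => this u, Finset.sum_add_distrib,
    Finset.sum_ite_eq' Finset.univ v]
  simp

/-- Trading one unit of weight at `v` for a loop with the last label. -/
noncomputable def addLoop (A : LabelledGraph g n k) (v : A.graph.V) (hv : 0 < A.graph.w v) :
    LabelledGraph g n (k + 1) :=
  ofLab (A.loopGraph v) (Sum.elim (fun h => (A.lab h).castSucc) fun _ => Fin.last k)
    (fun l => by
      induction l using Fin.lastCases with
      | last => exact ⟨Sum.inr true, rfl⟩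
      | cast l =>
        obtain ⟨h, rfl⟩ := A.lab_surj l
        exact ⟨Sum.inl h, rfl⟩)
    (by
      rintro (h | b) (h' | b')
      · simp [loopGraph, A.lab_eq_iff]
      · simp [loopGraph, Fin.castSucc_ne_last]
      · simp [loopGraph, (Fin.castSucc_ne_last _).symm]
      · cases b <;> cases b' <;> simp [loopGraph])
    ⟨A.graph.connected.1, fun u u' => rel_of_forall_inc (A := A)
      (P := fun u u' => (A.loopGraph v).joined Set.univ u u')
      ⟨fun _ => Setoid.refl' _ _, fun h => Setoid.symm' _ h, fun h h' => Setoid.trans' _ h h'⟩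
      (fun l a b ha hb => by
        obtain ⟨h, rfl, rfl⟩ := ha
        rcases (A.inc_iff h b).1 hb with rfl | rfl
        · exact Setoid.refl' _ _
        · exact Relation.EqvGen.rel _ _ ⟨Sum.inl h, trivial, rfl, rfl⟩) u u'⟩
    (A.loopWeight v) A.graph.m
    (by
      have h1 := A.genus_eq
      have h2 := A.sum_loopWeight v hv
      change k + 1 + 1 + ∑ u : A.graph.V, A.loopWeight v u = g + Fintype.card A.graph.V
      omega)
    (fun u => by
      classical
      have h1 := A.loopGraph_val v u
      have h2 := A.stable' u
      rw [h1]
      change 2 < 2 * A.loopWeight v u + _ + Nat.card {i : Fin n // A.graph.m i = u}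
      unfold loopWeight
      split_ifs with hu
      -- At `v`, twice the weight drops by two and the valence rises by two. Positivity keeps the
      -- subtraction in `loopWeight` from truncating.
      · have hu0 : 0 < A.graph.w u := by rw [hu]; exact hv
        omega
      · omega)

/-- Contracting the new loop gives the unit of weight back to `v`. By uniqueness of contractions it
suffices to exhibit `A` as one. -/
lemma face_addLoop (A : LabelledGraph g n k) (v : A.graph.V) (hv : 0 < A.graph.w v) :
    Nonempty (Iso ((A.addLoop v hv).face (Fin.succAboveEmb (Fin.last k))) A) := by
  classical
  have hlast : ∀ {u : A.graph.V}, (A.addLoop v hv).inc u (Fin.last k) ↔ u = v := fun {u} => by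
    constructor
    · rintro ⟨h | b, hl, rfl⟩
      · exact (Fin.castSucc_ne_last _ hl).elim
      · rfl
    · rintro rfl; exact ⟨Sum.inr true, rfl, rfl⟩
  refine (contractsFace _ _).unique
    { f := id
      t := Sum.inl
      f_surj := fun x => ⟨x, rfl⟩
      t_inj := Sum.inl_injective
      t_range := ?_
      lab_t := fun h => (Fin.succAbove_last_apply (A.lab h)).symm
      f_r := fun _ => rfl
      t_s := fun _ => rfl
      f_m := fun _ => rfl
      f_eq := fun x y => ?_
      f_w := fun c => ?_ }
  · rintro (h | b)
    · exact fun _ => ⟨h, rfl⟩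
    · intro h
      exact ((notMem_range_succAboveEmb (Fin.last k) (Fin.last k)).2 rfl h).elim
  · rw [joined_succAbove_iff]
    constructor
    · exact Or.inl
    · rintro (h | ⟨h, h'⟩)
      exacts [h, (hlast.1 h).trans (hlast.1 h').symm]
  · have h1 : ∑ u : (A.addLoop v hv).graph.V with id u = c, (((A.addLoop v hv).graph.w u : ℤ) - 1)
        = (A.loopWeight v c : ℤ) - 1 :=
      Finset.sum_eq_single_of_mem (M := ℤ) c (Finset.mem_filter.2 ⟨Finset.mem_univ _, rfl⟩)
        fun u hu hne => (hne (Finset.mem_filter.1 hu).2).elim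
    have h2 : (Finset.univ.filter fun i => i ∉ Set.range (Fin.succAboveEmb (Fin.last k)) ∧
        ∃ h, (A.addLoop v hv).lab h = i ∧ id ((A.addLoop v hv).graph.r h) = c).card
        = if c = v then 1 else 0 := by
      split_ifs with hc
      · refine Finset.card_eq_one.2 ⟨Fin.last k, Finset.ext fun i => ?_⟩
        rw [Finset.mem_filter, notMem_range_succAboveEmb, Finset.mem_singleton]
        refine ⟨fun h => h.2.1, ?_⟩
        rintro rfl
        exact ⟨Finset.mem_univ _, rfl, hlast.2 hc⟩
      · refine Finset.card_eq_zero.2 (Finset.eq_empty_of_forall_notMem fun i hi => ?_)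
        rw [Finset.mem_filter, notMem_range_succAboveEmb] at hi
        obtain ⟨-, rfl, h⟩ := hi
        exact hc (hlast.1 h)
    refine Eq.trans ?_ (congrArg₂ (· + ·) h1.symm (congrArg (Nat.cast (R := ℤ)) h2.symm))
    unfold loopWeight
    split_ifs with hc
    · subst hc
      push_cast [Nat.cast_sub (show 1 ≤ A.graph.w c from hv)]
      ring
    · simp

end LabelledGraph

namespace TropSimplex

variable {g n : ℕ}

/-- Every simplex is a face of one with the same number of vertices and without weights. -/
lemma exists_weightless_coface (d : ℕ) : ∀ {k : ℕ} (x : TropSimplex g n k),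
    k + 1 + d = g + x.numVertices → ∃ (K : ℕ) (ι : Fin k ↪ Fin K) (y : TropSimplex g n K),
      y.face ι = x ∧ y.numVertices = x.numVertices ∧ K + 1 = g + y.numVertices := by
  -- By the genus formula, `d` is the total weight of `x`.
  induction d with
  | zero => intro k x hx; exact ⟨k, Function.Embedding.refl _, x, face_refl x, rfl, hx⟩
  | succ d ih =>
    intro k x hx
    obtain ⟨A, rfl⟩ := mk_surj x
    have h1 := A.genus_eq
    rw [numVertices_mk] at hx
    obtain ⟨v, -, hv⟩ : ∃ v ∈ Finset.univ, 0 < A.graph.w v := by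
      by_contra! hcon
      rw [Finset.sum_eq_zero fun v hv => Nat.le_zero.1 (hcon v hv)] at h1
      omega
    obtain ⟨K, ι, y, hy, hny, hK⟩ := ih (mk (A.addLoop v hv)) (by
      change k + 1 + 1 + d = g + Fintype.card A.graph.V; omega)
    refine ⟨K, (Fin.succAboveEmb (Fin.last k)).trans ι, y, ?_, hny, hK⟩
    rw [← face_face, hy, face_mk]
    exact mk_eq_iff.2 (A.face_addLoop v hv)

end TropSimplex

/-! ## Reconstruction of a weightless graph from its contractions -/

namespace LabelledGraph

variable {g n k : ℕ}

/-- The label `l` or the marking `i` sits at the vertex `v`. -/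
def itemInc (A : LabelledGraph g n k) (v : A.graph.V) : Fin k ⊕ Fin n → Prop :=
  Sum.elim (A.inc v) fun i => A.graph.m i = v

open scoped Classical in
/-- The multiplicity of labels and markings: loops, which are the labels outside `L`, count
twice. -/
noncomputable def itemMult (L : Set (Fin k)) : Fin k ⊕ Fin n → ℕ :=
  Sum.elim (fun l => if l ∈ L then 1 else 2) fun _ => 1

lemma itemMult_eq_one (L : Set (Fin k)) :
    ∀ e ∈ (Sum.inl '' L : Set (Fin k ⊕ Fin n)), itemMult L e = 1 := by
  rintro _ ⟨l, hl, rfl⟩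
  exact if_pos hl

-- A loop contributes two half-edges to its vertex, hence its multiplicity two. For zero weights,
-- stability thus says that every degree is at least three.
open scoped Classical in
lemma sum_itemMult (A : LabelledGraph g n k) {L : Set (Fin k)} (hL : ∀ l, l ∈ L ↔ ¬ A.IsLoop l)
    (v : A.graph.V) : ∑ i with A.itemInc v i, itemMult L i
      = A.graph.val v + Nat.card {i : Fin n // A.graph.m i = v} := by
  rw [Finset.sum_filter, Fintype.sum_sum_type]
  congr 1
  · rw [HGraph.val_eq_sum, ← Finset.sum_fiberwise Finset.univ A.lab]
    refine Finset.sum_congr rfl fun l _ => ?_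
    obtain ⟨h, rfl⟩ := A.lab_surj l
    have h1 : (Finset.univ.filter fun h' => A.lab h' = A.lab h) = {h, A.graph.s h} := by
      ext h'
      simp only [Finset.mem_filter, Finset.mem_univ, true_and, Finset.mem_insert,
        Finset.mem_singleton]
      rw [eq_comm, A.lab_eq_iff]
    rw [h1, Finset.sum_pair (A.graph.s_ne h).symm]
    simp only [itemInc, Sum.elim_inl, itemMult, hL, A.isLoop_iff, A.inc_iff]
    by_cases ha : A.graph.r h = v <;> by_cases hb : A.graph.r (A.graph.s h) = v
    · simp [ha, hb]
    · simp [ha, hb, Ne.symm hb]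
    · simp [ha, hb, Ne.symm ha]
    · simp [ha, hb, Ne.symm ha, Ne.symm hb]
  · simp only [itemInc, itemMult, Sum.elim_inr]
    rw [Nat.card_eq_fintype_card, Fintype.card_subtype, Finset.card_filter]
    exact Finset.sum_congr rfl fun _ _ => if_congr Iff.rfl rfl rfl

lemma two_ends (A : LabelledGraph g n k) {l : Fin k} (hl : ¬ A.IsLoop l) :
    ∃ a b, a ≠ b ∧ ∀ x, A.inc x l ↔ x = a ∨ x = b := by
  obtain ⟨h, rfl⟩ := A.lab_surj l
  rw [isLoop_iff] at hl
  exact ⟨_, _, Ne.symm hl, A.inc_iff h⟩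

/-- The incidence system of edges and markings of a weightless graph. -/
noncomputable def incidence (A : LabelledGraph g n k) (L : Set (Fin k))
    (hL : ∀ l, l ∈ L ↔ ¬ A.IsLoop l) (hw : ∀ v, A.graph.w v = 0) :
    IncidenceSystem (Fin k ⊕ Fin n) (Sum.inl '' L) (itemMult L) where
  V := A.graph.V
  inc := A.itemInc
  two_ends := by
    rintro _ ⟨l, hl, rfl⟩
    exact A.two_ends ((hL l).1 hl)
  one_end := by
    rintro (l | i) hi
    · have hl : A.IsLoop l := by
        by_contra hl
        exact hi ⟨l, (hL l).2 hl, rfl⟩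
      obtain ⟨h, rfl⟩ := A.lab_surj l
      refine ⟨A.graph.r h, fun x => ?_⟩
      change A.inc x _ ↔ _
      rw [inc_iff, hl h rfl, or_self]
    · exact ⟨A.graph.m i, fun x => eq_comm⟩
  conn U := by
    rintro ⟨u, hu⟩ hne
    by_contra! hcon
    refine hne (Set.eq_univ_of_forall fun v => ?_)
    refine (rel_of_forall_inc (A := A) (P := fun a b => a ∈ U ↔ b ∈ U)
      ⟨fun _ => Iff.rfl, Iff.symm, Iff.trans⟩ (fun l a b ha hb => ?_) u v).1 hu
    by_cases hl : A.IsLoop l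
    · rw [hl.eq_of_inc ha hb]
    · have hlN : Sum.inl l ∈ (Sum.inl '' L : Set (Fin k ⊕ Fin n)) := ⟨l, (hL l).2 hl, rfl⟩
      constructor
      · intro haU
        by_contra hbU
        exact hcon _ hlN a haU b hbU ha hb
      · intro hbU
        by_contra haU
        exact hcon _ hlN b hbU a haU hb ha
  stable v := by
    rw [sum_itemMult A hL v]
    have := A.stable' v
    rw [hw] at this
    omega

/-- As `v` is off `e`, it forms a class of its own in the contraction. Its image is the class of
some `x` in `B`: if `x` is off `e`, this class is `x` alone and the items agree; otherwise it is the
merged vertex, with all items at the ends of `e` other than `e`. -/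
lemma itemInc_contract {A B : LabelledGraph g n (k + 1)} {e : Fin (k + 1)}
    (ψ : Iso (A.face (Fin.succAboveEmb e)) (B.face (Fin.succAboveEmb e))) (v : A.graph.V)
    (hv : ¬ A.inc v e) :
    (∃ x, ∀ i, A.itemInc v i ↔ B.itemInc x i) ∨
      ∀ i, A.itemInc v i ↔ i ≠ Sum.inl e ∧ ∃ x, B.itemInc x (Sum.inl e) ∧ B.itemInc x i := by
  obtain ⟨x, hx⟩ := HGraph.comp_surj (B.missed (Fin.succAboveEmb e))
    (ψ.onV (A.graph.comp (A.missed (Fin.succAboveEmb e)) v))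
  have hA : ∀ u, A.graph.joined (A.missed (Fin.succAboveEmb e)) u v ↔ u = v := fun u => by
    rw [joined_succAbove_iff]; tauto
  have key : ∀ i, i ≠ Sum.inl e → (A.itemInc v i ↔
      ∃ u, B.graph.joined (B.missed (Fin.succAboveEmb e)) u x ∧ B.itemInc u i) := by
    rintro (l | i) hi
    · obtain ⟨l, rfl⟩ := Fin.exists_succAbove_eq (x := l) (y := e) fun h => hi (congrArg _ h)
      have h1 := face_inc_iff (A := A) (Fin.succAboveEmb e) v l
      have h2 := face_inc_iff (A := B) (Fin.succAboveEmb e) x l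
      have h3 := ψ.inc_iff (A.graph.comp (A.missed (Fin.succAboveEmb e)) v) l
      simp only [hA, exists_eq_left] at h1
      exact h1.symm.trans (h3.symm.trans (Iff.trans (by rw [← hx]) h2))
    · have h1 : A.graph.m i = v ↔ A.graph.comp (A.missed (Fin.succAboveEmb e)) (A.graph.m i)
          = A.graph.comp (A.missed (Fin.succAboveEmb e)) v := by
        rw [HGraph.comp_eq_iff, hA]
      have h2 : ψ.onV (A.graph.comp (A.missed (Fin.succAboveEmb e)) (A.graph.m i))
          = B.graph.comp (B.missed (Fin.succAboveEmb e)) (B.graph.m i) := ψ.map_m i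
      change A.graph.m i = v ↔ ∃ u, _ ∧ B.graph.m i = u
      refine (h1.trans ψ.onV.injective.eq_iff.symm).trans ?_
      constructor
      · intro h
        exact ⟨_, HGraph.comp_eq_iff.1 (h2.symm.trans (h.trans hx.symm)), rfl⟩
      · rintro ⟨_, h, rfl⟩
        exact h2.trans ((HGraph.comp_eq_iff.2 h).trans hx)
  simp only [joined_succAbove_iff] at key
  have hve : ¬ A.itemInc v (Sum.inl e) := hv
  by_cases hxe : B.inc x e
  · right
    intro i
    by_cases hi : i = Sum.inl e
    · subst hi
      simp [hve]
    · rw [key i hi]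
      simp only [hi, ne_eq, not_false_eq_true, true_and]
      refine exists_congr fun u => and_congr_left fun _ => ?_
      change _ ↔ B.inc u e
      constructor
      · rintro (rfl | h); exacts [hxe, h.1]
      · exact fun h => Or.inr ⟨h, hxe⟩
  · left
    refine ⟨x, fun i => ?_⟩
    by_cases hi : i = Sum.inl e
    · subst hi
      exact iff_of_false hve hxe
    · rw [key i hi]
      simp [hxe]

/-- Contracting `e` turns a non-loop edge `f ≠ e` into a loop exactly if `f` is parallel to `e`, and
isomorphisms preserve loops. -/
lemma parallel_of_iso {A B : LabelledGraph g n (k + 1)} {e f : Fin (k + 1)}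
    (ψ : Iso (A.face (Fin.succAboveEmb e)) (B.face (Fin.succAboveEmb e)))
    (hfA : ¬ A.IsLoop f) (heA : ¬ A.IsLoop e) (hfB : ¬ B.IsLoop f) (heB : ¬ B.IsLoop e)
    (h : ∀ u, A.inc u e → A.inc u f) (x : B.graph.V) (hx : B.inc x e) : B.inc x f := by
  by_cases hfe : f = e
  · rwa [hfe]
  obtain ⟨f, rfl⟩ := Fin.exists_succAbove_eq hfe
  have h1 : (A.face (Fin.succAboveEmb e)).IsLoop f := by
    rw [face_isLoop_iff]
    intro u v hu hv
    obtain ⟨a, b, hab, hends⟩ := A.two_ends heA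
    obtain ⟨c, d, hcd, hends'⟩ := A.two_ends hfA
    have ha := (hends' a).1 (h a ((hends a).2 (Or.inl rfl)))
    have hb := (hends' b).1 (h b ((hends b).2 (Or.inr rfl)))
    have hu' := (hends' u).1 hu
    have hv' := (hends' v).1 hv
    rw [joined_succAbove_iff, hends, hends]
    grind
  have h2 := (ψ.isLoop_iff f).2 h1
  rw [face_isLoop_iff] at h2
  obtain ⟨a, b, hab, hends⟩ := B.two_ends heB
  obtain ⟨c, d, hcd, hends'⟩ := B.two_ends hfB
  have h3 := h2 c d ((hends' c).2 (Or.inl rfl)) ((hends' d).2 (Or.inr rfl))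
  rw [joined_succAbove_iff, hends, hends] at h3
  rw [hends] at hx
  rw [hends']
  grind

/-- A weightless graph with at least three vertices is determined by the contractions of its
edges. -/
theorem nonempty_iso_of_contractions {A B : LabelledGraph g n (k + 1)}
    (hwA : ∀ v, A.graph.w v = 0) (hwB : ∀ v, B.graph.w v = 0)
    (hcard : Fintype.card A.graph.V = Fintype.card B.graph.V) (h3 : 3 ≤ Fintype.card A.graph.V)
    (hloop : ∀ l, A.IsLoop l ↔ B.IsLoop l)
    (hface : ∀ e, ¬ A.IsLoop e →
      Nonempty (Iso (A.face (Fin.succAboveEmb e)) (B.face (Fin.succAboveEmb e)))) :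
    Nonempty (Iso A B) := by
  let L : Set (Fin (k + 1)) := {l | ¬ A.IsLoop l}
  have hLA : ∀ l, l ∈ L ↔ ¬ A.IsLoop l := fun l => Iff.rfl
  have hLB : ∀ l, l ∈ L ↔ ¬ B.IsLoop l := fun l => not_congr (hloop l)
  have hface' : ∀ e, ¬ A.IsLoop e →
      Nonempty (Iso (B.face (Fin.succAboveEmb e)) (A.face (Fin.succAboveEmb e))) := fun e he =>
    (isoSetoid g n k).symm (hface e he)
  have hmatch : (A.incidence L hLA hwA).Matching (B.incidence L hLB hwB) := by
    refine ⟨hcard, h3, ?_, ?_, ?_, ?_⟩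
    · rintro _ ⟨e, he, rfl⟩ v hv
      obtain ⟨ψ⟩ := hface e he
      exact itemInc_contract ψ v hv
    · rintro _ ⟨e, he, rfl⟩ v hv
      obtain ⟨ψ⟩ := hface' e he
      exact itemInc_contract ψ v hv
    · rintro _ ⟨e, he, rfl⟩ _ ⟨f, hf, rfl⟩ h x hx
      obtain ⟨ψ⟩ := hface e he
      exact parallel_of_iso ψ hf he ((hLB _).1 hf) ((hLB _).1 he) h x hx
    · rintro _ ⟨e, he, rfl⟩ _ ⟨f, hf, rfl⟩ h x hx
      obtain ⟨ψ⟩ := hface' e he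
      exact parallel_of_iso ψ ((hLB _).1 hf) ((hLB _).1 he) hf he h x hx
  obtain ⟨φ, hφ⟩ := hmatch.exists_equiv (itemMult_eq_one L)
  change A.graph.V ≃ B.graph.V at φ
  replace hφ : ∀ v i, A.itemInc v i ↔ B.itemInc (φ v) i := hφ
  refine nonempty_iso_of_equiv φ (fun v => by rw [hwA, hwB])
    (fun i => ((hφ (A.graph.m i) (Sum.inr i)).1 rfl).symm) fun l => ?_
  obtain ⟨h, rfl⟩ := A.lab_surj l
  obtain ⟨h', hh'⟩ := B.lab_surj (A.lab h)
  have key : ∀ v, (v = A.graph.r h ∨ v = A.graph.r (A.graph.s h)) ↔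
      (φ v = B.graph.r h' ∨ φ v = B.graph.r (B.graph.s h')) := fun v => by
    rw [← A.inc_iff, ← B.inc_iff, hh']
    exact hφ v (Sum.inl (A.lab h))
  have k1 := (key _).1 (Or.inl rfl)
  have k2 := (key _).1 (Or.inr rfl)
  have k3 := key (φ.symm (B.graph.r h'))
  have k4 := key (φ.symm (B.graph.r (B.graph.s h')))
  rw [Equiv.apply_symm_apply] at k3 k4
  have k3 := k3.2 (Or.inl rfl)
  have k4 := k4.2 (Or.inr rfl)
  rw [Equiv.symm_apply_eq, Equiv.symm_apply_eq] at k3 k4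
  -- `φ` respects the unordered pair of ends; the two cases decide which half-edge of `B`
  -- corresponds to `h`.
  have : (φ (A.graph.r h) = B.graph.r h' ∧ φ (A.graph.r (A.graph.s h)) = B.graph.r (B.graph.s h'))
      ∨ (φ (A.graph.r h) = B.graph.r (B.graph.s h') ∧
        φ (A.graph.r (A.graph.s h)) = B.graph.r h') := by
    grind
  rcases this with ⟨a, b⟩ | ⟨a, b⟩
  · exact ⟨h, h', rfl, hh', a, b⟩
  · exact ⟨h, B.graph.s h', rfl, by rw [B.lab_s, hh'], a, by rw [B.graph.s_s, b]⟩

end LabelledGraph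

/-! ## Bijections that commute with faces -/

/-- A family of bijections on the simplices of `Δ_{g,n}` that commutes with all face maps. -/
structure SimplexAut (g n : ℕ) where
  toFun : ∀ {k : ℕ}, TropSimplex g n k → TropSimplex g n k
  invFun : ∀ {k : ℕ}, TropSimplex g n k → TropSimplex g n k
  inv_to : ∀ {k : ℕ} (x : TropSimplex g n k), invFun (toFun x) = x
  to_inv : ∀ {k : ℕ} (x : TropSimplex g n k), toFun (invFun x) = x
  map_face : ∀ {j k : ℕ} (ι : Fin j ↪ Fin k) (x : TropSimplex g n k),
    toFun (x.face ι) = (toFun x).face ι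

namespace SimplexAut

variable {g n : ℕ}

def symm (F : SimplexAut g n) : SimplexAut g n where
  toFun := F.invFun
  invFun := F.toFun
  inv_to := F.to_inv
  to_inv := F.inv_to
  map_face ι x := by rw [← F.inv_to ((F.invFun x).face ι), F.map_face, F.to_inv]

/-- This expresses loops by vertex numbers of faces, so families that preserve these numbers
preserve loop labels. -/
lemma isLoop_iff_numVertices {k : ℕ} (A : LabelledGraph g n (k + 1)) (l : Fin (k + 1)) :
    A.IsLoop l ↔
      ((TropSimplex.mk A).face (Fin.succAboveEmb l)).numVertices = (TropSimplex.mk A).numVertices := by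
  rw [TropSimplex.face_mk, TropSimplex.numVertices_mk, TropSimplex.numVertices_mk]
  refine ⟨LabelledGraph.card_face_of_isLoop, fun h => ?_⟩
  by_contra hl
  have := LabelledGraph.card_face_of_not_isLoop hl
  omega

/-- If one-vertex graphs are preserved, then so is the number of vertices. -/
lemma numVertices_eq_of_roses
    (H : ∀ (F : SimplexAut g n) {k : ℕ} (x : TropSimplex g n k), x.numVertices = 1 →
      (F.toFun x).numVertices = 1) (F : SimplexAut g n) {k : ℕ} (x : TropSimplex g n k) :
    (F.toFun x).numVertices = x.numVertices := by
  -- The claim ranges over all families so that it also applies to the inverse. The same contraction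
  -- makes both `x` and `F x` a rose, and it removes at most one vertex of `F x` per contracted
  -- edge.
  have key : ∀ (F : SimplexAut g n) (x : TropSimplex g n k),
      (F.toFun x).numVertices ≤ x.numVertices := fun F x => by
    have hpos := x.numVertices_pos
    obtain ⟨j, ι, hj, hι⟩ := TropSimplex.exists_face_numVertices_eq_one (x.numVertices - 1) x
      (by omega)
    have h1 := H F _ hι
    rw [F.map_face] at h1
    have h2 := TropSimplex.numVertices_le_face ι (F.toFun x)
    omega
  refine le_antisymm (key F x) ?_
  have := key F.symm (F.toFun x)
  rwa [show F.symm.toFun (F.toFun x) = x from F.inv_to x] at this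

lemma weight_eq_zero {k : ℕ} {A : LabelledGraph g n k}
    (h : k + 1 = g + Fintype.card A.graph.V) (v : A.graph.V) : A.graph.w v = 0 := by
  have h1 := A.genus_eq
  have h2 : ∑ v, A.graph.w v = 0 := by omega
  exact Finset.sum_eq_zero_iff.1 h2 v (Finset.mem_univ _)

/-- A face-preserving family that preserves the number of vertices and fixes the graphs with at most
two vertices is the identity. -/
theorem eq_self_of_fixes (F : SimplexAut g n)
    (hF : ∀ {k : ℕ} (x : TropSimplex g n k), (F.toFun x).numVertices = x.numVertices)
    (hfix : ∀ {k : ℕ} (x : TropSimplex g n k), x.numVertices ≤ 2 → F.toFun x = x)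
    (N : ℕ) : ∀ {k : ℕ} (x : TropSimplex g n k), x.numVertices = N → F.toFun x = x := by
  induction N using Nat.strong_induction_on with
  | _ N ih =>
    -- The reconstruction compares item sets only and does not see weights, so the weightless case
    -- is treated separately.
    have hweightless : ∀ {k : ℕ} (x : TropSimplex g n k), x.numVertices = N → 3 ≤ N →
        k + 1 = g + N → F.toFun x = x := by
      intro k x hx h3 hk
      obtain ⟨A, rfl⟩ := TropSimplex.mk_surj x
      obtain ⟨B, hB⟩ := TropSimplex.mk_surj (F.toFun (TropSimplex.mk A))
      have hcard := hF (TropSimplex.mk A)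
      rw [← hB] at hcard ⊢
      rw [TropSimplex.numVertices_mk] at hx hcard
      rw [TropSimplex.numVertices_mk] at hcard
      obtain ⟨l, -⟩ := A.exists_not_isLoop (by omega)
      obtain ⟨k, rfl⟩ : ∃ k', k = k' + 1 := ⟨k - 1, by have := l.pos; omega⟩
      have hface : ∀ e, (TropSimplex.mk B).face (Fin.succAboveEmb e)
          = F.toFun ((TropSimplex.mk A).face (Fin.succAboveEmb e)) := fun e => by
        rw [hB, F.map_face]
      refine (TropSimplex.mk_eq_iff.2 (LabelledGraph.nonempty_iso_of_contractions
        (weight_eq_zero (by omega)) (weight_eq_zero (by omega)) hcard.symm (by omega)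
        (fun l => ?_) fun e he => ?_)).symm
      · rw [isLoop_iff_numVertices, isLoop_iff_numVertices, hface, hF, hB, hF]
      · have h1 := LabelledGraph.card_face_of_not_isLoop he
        have h2 := ih (Fintype.card (A.face (Fin.succAboveEmb e)).graph.V) (by omega)
          (TropSimplex.mk (A.face (Fin.succAboveEmb e))) rfl
        have h3 := hface e
        rw [TropSimplex.face_mk, TropSimplex.face_mk, h2] at h3
        exact TropSimplex.mk_eq_iff.1 h3.symm
    intro k x hx
    by_cases h3 : 3 ≤ N
    · have hle := x.le_genus
      -- A graph with weights is a face of a weightless one with equally many vertices; as `F` fixes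
      -- the latter, it fixes the face.
      obtain ⟨K, ι, y, rfl, hny, hK⟩ := TropSimplex.exists_weightless_coface
        (g + x.numVertices - (k + 1)) x (by omega)
      rw [F.map_face, hweightless y (by omega) h3 (by omega)]
    · exact hfix x (by omega)

end SimplexAut

/-! ## Automorphisms of the functor -/

/-- The family of bijections that underlies an automorphism of `Δ_{g,n}`. -/
noncomputable def SimplexAut.ofAut {g n : ℕ} (Φ : Aut (tropicalModuli g n)) : SimplexAut g n where
  toFun {k} := fun x : TropSimplex g n k => Φ.hom.app (Opposite.op ⟨k⟩) x
  invFun {k} := fun x : TropSimplex g n k => Φ.inv.app (Opposite.op ⟨k⟩) x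
  inv_to {k} x := by
    have h := congrArg (fun α => α.app (Opposite.op ⟨k⟩)) Φ.hom_inv_id
    exact congrArg (fun f : (tropicalModuli g n).obj (Opposite.op ⟨k⟩) ⟶ _ => f x) h
  to_inv {k} x := by
    have h := congrArg (fun α => α.app (Opposite.op ⟨k⟩)) Φ.inv_hom_id
    exact congrArg (fun f : (tropicalModuli g n).obj (Opposite.op ⟨k⟩) ⟶ _ => f x) h
  map_face {j k} ι x :=
    NatTrans.naturality_apply Φ.hom (X := Opposite.op ⟨k⟩) (Y := Opposite.op ⟨j⟩)
      (Quiver.Hom.op (V := FinInj) (X := ⟨j⟩) (Y := ⟨k⟩) ι) x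

namespace SymmetricDeltaComplex

variable {X : SymmetricDeltaComplex} {Y : Subfunctor X}

lemma range_ι_comp_le (h : ∀ (Φ : Aut X) a, ∀ x ∈ Y.obj a, Φ.hom.app a x ∈ Y.obj a) (Φ : Aut X) :
    Subfunctor.range (Y.ι ≫ Φ.hom) ≤ Y := by
  rintro a _ ⟨x, rfl⟩
  exact h Φ a x.1 x.2

/-- The restriction homomorphism to a subcomplex that all automorphisms preserve. -/
def restrict (h : ∀ (Φ : Aut X) a, ∀ x ∈ Y.obj a, Φ.hom.app a x ∈ Y.obj a) :
    Aut X →* Aut Y.toFunctor where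
  toFun Φ :=
    { hom := Subfunctor.lift (Y.ι ≫ Φ.hom) (range_ι_comp_le h Φ)
      inv := Subfunctor.lift (Y.ι ≫ Φ.inv) (range_ι_comp_le h Φ⁻¹)
      hom_inv_id := by
        rw [← cancel_mono Y.ι, Category.assoc, Subfunctor.lift_ι, ← Category.assoc,
          Subfunctor.lift_ι, Category.assoc, Φ.hom_inv_id, Category.comp_id, Category.id_comp]
      inv_hom_id := by
        rw [← cancel_mono Y.ι, Category.assoc, Subfunctor.lift_ι, ← Category.assoc,
          Subfunctor.lift_ι, Category.assoc, Φ.inv_hom_id, Category.comp_id, Category.id_comp] }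
  map_one' := rfl
  map_mul' _ _ := rfl

lemma isRestriction_restrict
    (h : ∀ (Φ : Aut X) a, ∀ x ∈ Y.obj a, Φ.hom.app a x ∈ Y.obj a) : IsRestriction Y (restrict h) :=
  fun Φ => Subfunctor.lift_ι (Y.ι ≫ Φ.hom) (range_ι_comp_le h Φ)

end SymmetricDeltaComplex

/-- An element of the kernel fixes every graph with at most two vertices, so `eq_self_of_fixes`
makes it the identity. -/
lemma restrict_injective_of_numVertices {g n : ℕ}
    (H : ∀ (F : SimplexAut g n) {k : ℕ} (x : TropSimplex g n k),
      (F.toFun x).numVertices = x.numVertices) :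
    ∃ ρ : Aut (tropicalModuli g n) →* Aut (vertexSubcomplex g n 2).toFunctor,
      IsRestriction (vertexSubcomplex g n 2) ρ ∧ Function.Injective ρ := by
  have hpres : ∀ (Φ : Aut (tropicalModuli g n)) a, ∀ x ∈ (vertexSubcomplex g n 2).obj a,
      Φ.hom.app a x ∈ (vertexSubcomplex g n 2).obj a := fun Φ a x hx =>
    (H (SimplexAut.ofAut Φ) (k := a.unop.size) x).le.trans hx
  refine ⟨SymmetricDeltaComplex.restrict hpres,
    SymmetricDeltaComplex.isRestriction_restrict hpres, ?_⟩
  rw [injective_iff_map_eq_one]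
  intro Φ hΦ
  have hfix : ∀ {k : ℕ} (x : TropSimplex g n k), x.numVertices ≤ 2 →
      (SimplexAut.ofAut Φ).toFun x = x := fun {k} x hx => by
    have h1 := congrArg (fun α => α.hom.app (Opposite.op ⟨k⟩)) hΦ
    have h2 := congrArg (fun f : (vertexSubcomplex g n 2).toFunctor.obj (Opposite.op ⟨k⟩) ⟶ _ =>
      f (⟨x, hx⟩ : (vertexSubcomplex g n 2).obj (Opposite.op ⟨k⟩))) h1
    exact congrArg Subtype.val h2
  refine Iso.ext (NatTrans.ext (funext fun a => ?_))
  ext x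
  exact (SimplexAut.ofAut Φ).eq_self_of_fixes (H _) hfix _ (k := a.unop.size) x rfl

/-! ## The dipole and the graph with a single loop -/

/-- The graph with edges `Fin k` whose ends are given by `ends`. -/
def endsGraph {V : Type} [Fintype V] {k : ℕ} (ends : Fin k → Bool → V) : HGraph where
  V := V
  H := Fin k × Bool
  r h := ends h.1 h.2
  s h := (h.1, !h.2)
  s_s h := by simp
  s_ne h := by simp [Prod.ext_iff]

open scoped Classical in
lemma endsGraph_val {V : Type} [Fintype V] {k : ℕ} (ends : Fin k → Bool → V) (v : V) :
    (endsGraph ends).val v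
      = ∑ l, ((if ends l true = v then 1 else 0) + if ends l false = v then 1 else 0) := by
  have h : (endsGraph ends).val v = ∑ h : Fin k × Bool, if ends h.1 h.2 = v then 1 else 0 :=
    HGraph.val_eq_sum _ _
  rw [h, Fintype.sum_prod_type]
  exact Finset.sum_congr rfl fun _ _ => Fintype.sum_bool _

namespace LabelledGraph

variable {g n k : ℕ}

/-- The weightless stable graph with edges `Fin k` whose ends are given by `ends`. -/
noncomputable def ofEnds {V : Type} [Fintype V] (ends : Fin k → Bool → V)
    (connected : (endsGraph ends).Connected) (m : Fin n → V) (genus : k + 1 = g + Fintype.card V)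
    (stable : ∀ v : V, 2 < (endsGraph ends).val v + Nat.card {i : Fin n // m i = v}) :
    LabelledGraph g n k :=
  ofLab (endsGraph ends) Prod.fst (fun l => ⟨(l, true), rfl⟩)
    (by
      rintro ⟨l, b⟩ ⟨l', b'⟩
      cases b <;> cases b' <;> simp [endsGraph, eq_comm])
    connected (fun _ => 0) m (by rw [Finset.sum_const_zero]; exact genus) (fun v => by
      rw [mul_zero, zero_add]
      exact stable v)

lemma inc_ofEnds {V : Type} [Fintype V] {ends : Fin k → Bool → V}
    {connected : (endsGraph ends).Connected} {m : Fin n → V} {genus : k + 1 = g + Fintype.card V}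
    {stable : ∀ v : V, 2 < (endsGraph ends).val v + Nat.card {i : Fin n // m i = v}} (v : V)
    (l : Fin k) : (ofEnds ends connected m genus stable).inc v l ↔
      v = ends l true ∨ v = ends l false := by
  constructor
  · rintro ⟨⟨l, b⟩, rfl, rfl⟩
    cases b
    exacts [Or.inr rfl, Or.inl rfl]
  · rintro (rfl | rfl)
    exacts [⟨(l, true), rfl, rfl⟩, ⟨(l, false), rfl, rfl⟩]

lemma joined_endsGraph {V : Type} [Fintype V] (ends : Fin k → Bool → V) (l : Fin k) :
    (endsGraph ends).joined Set.univ (ends l true) (ends l false) :=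
  Relation.EqvGen.rel _ _ ⟨(l, true), trivial, rfl, rfl⟩

/-- The graph with two vertices that are joined by `g + 1` edges.  One vertex carries at most one
marking, the other vertex carries the rest. -/
noncomputable def dipole (g n : ℕ) (hg : 1 ≤ g) (h : 5 ≤ 2 * g + n) : LabelledGraph g n (g + 1) :=
  ofEnds (V := Bool) (fun _ b => b)
    ⟨⟨true⟩, fun u v => by
      have h := joined_endsGraph (fun (_ : Fin (g + 1)) b => b) 0
      cases u <;> cases v
      exacts [Setoid.refl' _ _, Setoid.symm' _ h, h, Setoid.refl' _ _]⟩
    (fun i => decide (i.val ≠ 0)) (by simp)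
    (fun v => by
      rw [endsGraph_val]
      -- Both valences are `g + 1`, which suffices for `g ≥ 2`. For `g = 1` there are at least three
      -- markings, so each vertex carries one.
      have hpos : 2 ≤ n → 0 < Nat.card {i : Fin n // decide (i.val ≠ 0) = v} := fun hn => by
        rw [Nat.card_pos_iff]
        refine ⟨?_, inferInstance⟩
        cases v
        exacts [⟨⟨0, by omega⟩, by simp⟩, ⟨⟨1, by omega⟩, by simp⟩]
      cases v <;> simp at hpos ⊢ <;> omega)

/-- As `g ≥ 1`, at least one edge is contracted, and this merges the two vertices. -/
lemma face_dipole_one (hg : 1 ≤ g) (h : 5 ≤ 2 * g + n) (ι : Fin 1 ↪ Fin (g + 1)) :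
    Fintype.card ((dipole g n hg h).face ι).graph.V = 1 := by
  obtain ⟨l, hl⟩ : ∃ l, l ∉ Set.range ι := by
    by_contra! hcon
    have := Fintype.card_le_of_surjective ι hcon
    simp only [Fintype.card_fin] at this
    omega
  refine Fintype.card_eq_one_iff.2 ⟨(dipole g n hg h).graph.comp _ true, fun c => ?_⟩
  obtain ⟨v, rfl⟩ := HGraph.comp_surj _ c
  refine HGraph.comp_eq_iff.2 (joined_of_inc ι hl ((inc_ofEnds _ _).2 ?_) ((inc_ofEnds _ _).2 ?_))
  · cases v
    exacts [Or.inr rfl, Or.inl rfl]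
  · exact Or.inl rfl

lemma joined_perm_iff (A : LabelledGraph g n k) (σ : Equiv.Perm (Fin k)) {u v : A.graph.V} :
    A.graph.joined (A.missed σ.toEmbedding) u v ↔ u = v := by
  constructor
  · exact joined_induction ⟨fun _ => rfl, Eq.symm, Eq.trans⟩ _
      fun l hl => (hl ⟨σ.symm l, σ.apply_symm_apply l⟩).elim
  · rintro rfl; exact Setoid.refl' _ _

/-- All edges join the same two vertices, so a relabelling is undone by permuting the edges and
fixing both vertices. -/
lemma face_dipole_perm (hg : 1 ≤ g) (h : 5 ≤ 2 * g + n) (σ : Equiv.Perm (Fin (g + 1))) :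
    Nonempty (Iso ((dipole g n hg h).face σ.toEmbedding) (dipole g n hg h)) := by
  classical
  have hσ : ∀ l, l ∈ Set.range σ.toEmbedding := fun l => ⟨σ.symm l, σ.apply_symm_apply l⟩
  refine (contractsFace _ _).unique
    { f := id
      t := Prod.map σ id
      f_surj := fun x => ⟨x, rfl⟩
      t_inj := σ.injective.prodMap fun _ _ => id
      t_range := fun h _ => ⟨(σ.symm h.1, h.2), Prod.ext (σ.apply_symm_apply _) rfl⟩
      lab_t := fun _ => rfl
      f_r := fun _ => rfl
      t_s := fun _ => rfl
      f_m := fun _ => rfl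
      f_eq := fun x y => (joined_perm_iff _ σ).symm
      f_w := fun c => ?_ }
  have h1 : ∑ u : (dipole g n hg h).graph.V with id u = c, (((dipole g n hg h).graph.w u : ℤ) - 1)
      = ((dipole g n hg h).graph.w c : ℤ) - 1 :=
    Finset.sum_eq_single_of_mem (M := ℤ) c (Finset.mem_filter.2 ⟨Finset.mem_univ _, rfl⟩)
      fun u hu hne => (hne (Finset.mem_filter.1 hu).2).elim
  rw [h1, Finset.filter_false_of_mem fun l _ hl => hl.1 (hσ l)]
  simp

/-! ### Trees on which all permutations of the labels act -/

/-- A graph that is isomorphic to a relabelling of itself has a symmetry. -/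
lemma exists_symmetry {A : LabelledGraph g n k} {σ : Equiv.Perm (Fin k)}
    (h : Nonempty (Iso (A.face σ.toEmbedding) A)) :
    ∃ φ : A.graph.V → A.graph.V, Function.Injective φ ∧ (∀ v l, A.inc (φ v) l ↔ A.inc v (σ l)) ∧
      (∀ i, φ (A.graph.m i) = A.graph.m i) ∧ ∀ v, A.graph.w (φ v) = A.graph.w v := by
  classical
  obtain ⟨ψ⟩ := h
  have hc : ∀ {u v}, A.graph.comp (A.missed σ.toEmbedding) u
      = A.graph.comp (A.missed σ.toEmbedding) v ↔ u = v := fun {u v} =>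
    HGraph.comp_eq_iff.trans (A.joined_perm_iff σ)
  refine ⟨fun v => ψ.onV (A.graph.comp (A.missed σ.toEmbedding) v),
    fun u v huv => hc.1 (ψ.onV.injective huv), fun v l => ?_, ψ.map_m, fun v => ?_⟩
  · have h1 := face_inc_iff (A := A) σ.toEmbedding v l
    simp only [joined_perm_iff, exists_eq_left] at h1
    exact (ψ.inc_iff _ l).trans h1
  · refine (ψ.map_w _).trans ?_
    have h1 := (contractsFace σ.toEmbedding A).f_w (A.graph.comp (A.missed σ.toEmbedding) v)
    have h2 : (Finset.univ.filter fun u =>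
        (contractsFace σ.toEmbedding A).f u = A.graph.comp (A.missed σ.toEmbedding) v) = {v} := by
      ext u
      rw [Finset.mem_filter, Finset.mem_singleton]
      exact ⟨fun h => hc.1 h.2, fun h => ⟨Finset.mem_univ _, hc.2 h⟩⟩
    rw [h2, Finset.sum_singleton, Finset.filter_false_of_mem fun l _ hl =>
      hl.1 ⟨σ.symm l, σ.apply_symm_apply l⟩, Finset.card_empty] at h1
    have h3 : (((A.face σ.toEmbedding).graph.w (A.graph.comp (A.missed σ.toEmbedding) v) : ℕ) : ℤ)
        = A.graph.w v := by
      push_cast at h1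
      linarith
    exact_mod_cast h3

lemma sum_val (A : LabelledGraph g n k) : ∑ v, A.graph.val v = 2 * k := by
  classical
  have h1 : ∑ v, A.graph.val v = Fintype.card A.graph.H := by
    rw [← Finset.card_univ, Finset.card_eq_sum_card_fiberwise (f := A.graph.r)
      (t := Finset.univ) (fun _ _ => Finset.mem_coe.2 (Finset.mem_univ _))]
    refine Finset.sum_congr rfl fun v _ => ?_
    unfold HGraph.val
    congr!
  have h2 : Fintype.card A.graph.H = ∑ _e : A.graph.E, 2 := by
    rw [← Finset.card_univ, Finset.card_eq_sum_card_fiberwise (f := A.graph.edge)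
      (t := Finset.univ) (fun _ _ => Finset.mem_coe.2 (Finset.mem_univ _))]
    refine Finset.sum_congr rfl fun e _ => ?_
    rw [← HGraph.card_halfEdges e]
  rw [h1, h2, Finset.sum_const, Finset.card_univ, A.card_edges, smul_eq_mul, mul_comm]

lemma exists_inc (A : LabelledGraph g n k) (h2 : 2 ≤ Fintype.card A.graph.V) (v : A.graph.V) :
    ∃ h, A.graph.r h = v := by
  by_contra! hcon
  have hinc : ∀ l, ¬ A.inc v l := by
    rintro l ⟨h, -, hr⟩
    exact hcon h hr
  have hall : ∀ u, u = v := fun u =>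
    (rel_of_forall_inc (A := A) (P := fun a b => a = v ↔ b = v)
      ⟨fun _ => Iff.rfl, Iff.symm, Iff.trans⟩ (fun l a b ha hb => by
        constructor
        · rintro rfl; exact (hinc l ha).elim
        · rintro rfl; exact (hinc l hb).elim) u v).2 rfl
  have := Fintype.card_le_one_iff.2 fun a b => (hall a).trans (hall b).symm
  omega

/-- A tree has a vertex with a single half-edge. -/
lemma exists_leaf (A : LabelledGraph g n k) (hV : Fintype.card A.graph.V = k + 1) (hk : 1 ≤ k) :
    ∃ v e, A.graph.val v = 1 ∧ ∀ l, A.inc v l ↔ l = e := by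
  classical
  -- The valences sum to `2 * k`, which is less than twice the number of vertices.
  obtain ⟨v, -, hv⟩ : ∃ v ∈ Finset.univ, A.graph.val v < 2 := by
    by_contra! hcon
    have h1 := Finset.sum_le_sum hcon
    rw [sum_val, Finset.sum_const, Finset.card_univ, hV, smul_eq_mul] at h1
    omega
  obtain ⟨h, rfl⟩ := A.exists_inc (by omega) v
  have hmem : h ∈ Finset.univ.filter fun h' => A.graph.r h' = A.graph.r h := by simp
  have hle : (Finset.univ.filter fun h' => A.graph.r h' = A.graph.r h).card ≤ 1 := by
    have : (Finset.univ.filter fun h' => A.graph.r h' = A.graph.r h).card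
        = A.graph.val (A.graph.r h) := by
      unfold HGraph.val
      congr!
    omega
  have hpos := Finset.card_pos.2 ⟨h, hmem⟩
  refine ⟨A.graph.r h, A.lab h, ?_, fun l => ⟨?_, ?_⟩⟩
  · have : (Finset.univ.filter fun h' => A.graph.r h' = A.graph.r h).card
        = A.graph.val (A.graph.r h) := by
      unfold HGraph.val
      congr!
    omega
  · rintro ⟨h', rfl, hr⟩
    rw [Finset.card_le_one.1 hle h' (by simp [hr]) h hmem]
  · rintro rfl; exact A.inc_lab h

/-- A tree with at least two edges on which all permutations of the labels act has total weight at
least the number of its edges. -/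
lemma le_sum_weight_of_symmetric (A : LabelledGraph g n k) (hV : Fintype.card A.graph.V = k + 1)
    (hk : 2 ≤ k) (hσ : ∀ σ : Equiv.Perm (Fin k), Nonempty (Iso (A.face σ.toEmbedding) A)) :
    k ≤ ∑ v, A.graph.w v := by
  classical
  obtain ⟨v, e, hval, hinc⟩ := A.exists_leaf hV (by omega)
  -- The symmetry for the swap of `e` and `j` moves the leaf at `e` to a leaf whose only edge is
  -- `j`, so every label has its own leaf.
  choose φ hφ hφinc hφm hφw using fun j => exists_symmetry (hσ (Equiv.swap e j))
  have hj : ∀ j l, A.inc (φ j v) l ↔ l = j := fun j l => by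
    rw [hφinc, hinc, Equiv.swap_apply_eq_iff, Equiv.swap_apply_left]
  have hinj : Function.Injective fun j => φ j v := fun i j hij => by
    have h1 := (hj i i).2 rfl
    rw [show φ i v = φ j v from hij] at h1
    exact (hj j i).1 h1
  -- A marking at `v` is fixed by all symmetries, so the leaves of two different labels would
  -- coincide.
  have hm : Nat.card {i : Fin n // A.graph.m i = v} = 0 := by
    rw [Nat.card_eq_zero]
    refine Or.inl ⟨?_⟩
    rintro ⟨i, rfl⟩
    have h1 := hinj (a₁ := ⟨0, by omega⟩) (a₂ := ⟨1, by omega⟩)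
      ((hφm _ i).trans (hφm _ i).symm)
    simp at h1
  have hw : 1 ≤ A.graph.w v := by
    have := A.stable' v
    omega
  calc k = ∑ _j : Fin k, 1 := by simp
    _ ≤ ∑ j, A.graph.w (φ j v) := Finset.sum_le_sum fun j _ => by rw [hφw]; exact hw
    _ = ∑ u ∈ Finset.univ.image fun j => φ j v, A.graph.w u :=
      (Finset.sum_image fun a _ b _ h => hinj h).symm
    _ ≤ _ := Finset.sum_le_sum_of_subset (Finset.subset_univ _)

end LabelledGraph

namespace SimplexAut

variable {g n : ℕ}

/-- If `F x` is not a loop, no one-edge face of the image of the dipole is a loop, so that image is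
a tree. It inherits the full label symmetry of the dipole, which requires total weight at least `g +
1`. -/
lemma numVertices_one_edge (hg : 1 ≤ g) (h : 5 ≤ 2 * g + n) (F : SimplexAut g n)
    (x : TropSimplex g n 1) (hx : x.numVertices = 1) : (F.toFun x).numVertices = 1 := by
  by_contra hne
  let D := TropSimplex.mk (LabelledGraph.dipole g n hg h)
  have hface : ∀ ι : Fin 1 ↪ Fin (g + 1), ((F.toFun D).face ι).numVertices ≠ 1 := fun ι => by
    have h1 : (D.face ι).numVertices = 1 := LabelledGraph.face_dipole_one hg h ι
    rw [← F.map_face, TropSimplex.eq_of_numVertices_eq_one h1 hx]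
    exact hne
  have hpos := (F.toFun D).numVertices_pos
  obtain ⟨j, ι, hj, hι⟩ := TropSimplex.exists_face_numVertices_eq_one
    ((F.toFun D).numVertices - 1) (F.toFun D) (by omega)
  -- An edge that survives the contraction of a spanning tree would give a one-edge face with one
  -- vertex.
  have hj0 : j = 0 := by
    by_contra hj0
    let κ : Fin 1 ↪ Fin j := ⟨fun _ => ⟨0, by omega⟩, fun _ _ _ => Subsingleton.elim _ _⟩
    refine hface (κ.trans ι) ?_
    rw [← TropSimplex.face_face]
    have h1 := TropSimplex.numVertices_face_le κ ((F.toFun D).face ι)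
    have h2 := (((F.toFun D).face ι).face κ).numVertices_pos
    omega
  obtain ⟨B, hB⟩ := TropSimplex.mk_surj (F.toFun D)
  rw [← hB, TropSimplex.numVertices_mk] at hj hpos
  -- `B` has `g + 1` edges and `g + 2` vertices, so the genus formula gives total weight `g`.
  have h1 := B.le_sum_weight_of_symmetric (by omega) (by omega) fun σ =>
    TropSimplex.mk_eq_iff.1 (by
      rw [← TropSimplex.face_mk, hB, ← F.map_face]
      exact congrArg F.toFun (TropSimplex.mk_eq_iff.2 (LabelledGraph.face_dipole_perm hg h σ)))
  have h2 := B.genus_eq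
  omega

end SimplexAut

/-! ## The star of loops -/

namespace LabelledGraph

variable {g n k : ℕ}

lemma eq_of_inc_three (A : LabelledGraph g n k) {l : Fin k} {x y z : A.graph.V} (hx : A.inc x l)
    (hy : A.inc y l) (hz : A.inc z l) : x = y ∨ y = z ∨ x = z := by
  obtain ⟨h, rfl⟩ := A.lab_surj l
  rw [inc_iff] at hx hy hz
  grind

/-- The number of vertices that are merged into `c` is at most the excess
`2 w(c) - 2 + val(c) + |m⁻¹(c)|`. -/
lemma card_fiber_le_excess {j : ℕ} (A : LabelledGraph g n k) (ι : Fin j ↪ Fin k)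
    (c : (A.face ι).graph.V) :
    (A.graph.compVerts (A.missed ι) c).card + 2 ≤ 2 * (A.face ι).graph.w c
      + (A.face ι).graph.val c + Nat.card {i : Fin n // (A.face ι).graph.m i = c} := by
  classical
  let S := A.missed ι
  have hv := HGraph.sum_val_comp S c
  have hw := A.graph.contractWeight_sub_one S c
  have hm : ∑ v ∈ A.graph.compVerts S c, Nat.card {i : Fin n // A.graph.m i = v}
      = Nat.card {i : Fin n // A.graph.comp S (A.graph.m i) = c} := by
    simp only [Nat.card_eq_fintype_card, Fintype.card_subtype]
    rw [Finset.card_eq_sum_card_fiberwise (f := A.graph.m) (t := A.graph.compVerts S c)]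
    · refine Finset.sum_congr rfl fun v hv => congrArg Finset.card ?_
      ext h
      simp only [HGraph.compVerts, Finset.mem_filter, Finset.mem_univ, true_and] at hv ⊢
      constructor
      · rintro rfl; exact ⟨hv, rfl⟩
      · exact fun h => h.2
    · intro h hh
      simpa [HGraph.compVerts] using hh
  -- The excess is additive under contraction, and stability makes it at least one at every merged
  -- vertex.
  have hpos : ∑ v ∈ A.graph.compVerts S c, (1 : ℤ) ≤ ∑ v ∈ A.graph.compVerts S c,
      (2 * ((A.graph.w v : ℤ) - 1) + A.graph.val v + Nat.card {i : Fin n // A.graph.m i = v}) :=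
    Finset.sum_le_sum fun v _ => by
      have := A.graph.stable v
      linarith
  rw [Finset.sum_add_distrib, Finset.sum_add_distrib, ← Finset.mul_sum, Finset.sum_const,
    nsmul_eq_mul, mul_one] at hpos
  have hv' : ∑ v ∈ A.graph.compVerts S c, (A.graph.val v : ℤ)
      = (A.graph.toHGraph.contract S).val c + 2 * (A.graph.compEdges S c).card := by
    exact_mod_cast hv
  have hm' : ∑ v ∈ A.graph.compVerts S c, (Nat.card {i : Fin n // A.graph.m i = v} : ℤ)
      = Nat.card {i : Fin n // A.graph.comp S (A.graph.m i) = c} := by exact_mod_cast hm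
  rw [hv', hm'] at hpos
  have key : ((A.graph.compVerts S c).card : ℤ) + 2 ≤ 2 * (A.graph.contractWeight S c : ℤ)
      + (A.graph.toHGraph.contract S).val c
      + Nat.card {i : Fin n // A.graph.comp S (A.graph.m i) = c} := by linarith
  exact_mod_cast key

lemma Iso.val_eq {A B : LabelledGraph g n k} (φ : Iso A B) (v : A.graph.V) :
    B.graph.val (φ.onV v) = A.graph.val v := by
  classical
  rw [HGraph.val_eq_sum, HGraph.val_eq_sum]
  refine (Fintype.sum_equiv φ.onH _ _ fun h => ?_).symm
  rw [← φ.map_r, φ.onV.injective.eq_iff]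

lemma Iso.card_m_eq {A B : LabelledGraph g n k} (φ : Iso A B) (v : A.graph.V) :
    Nat.card {i : Fin n // B.graph.m i = φ.onV v} = Nat.card {i : Fin n // A.graph.m i = v} :=
  Nat.card_congr (Equiv.subtypeEquivRight fun i => by rw [← φ.map_m, φ.onV.injective.eq_iff])

/-- The ends of the edges of the star with a loop at each of its `g` leaves.  The first `g` edges
are the loops, the other edges join the leaves to the centre `none`. -/
def starEnds (g : ℕ) : Fin (g + g) → Bool → Option (Fin g) :=
  Fin.addCases (fun i _ => some i) fun i b => if b then some i else none

lemma starEnds_loop (i : Fin g) (b : Bool) : starEnds g (Fin.castAdd g i) b = some i := by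
  simp [starEnds]

lemma starEnds_bridge (i : Fin g) (b : Bool) :
    starEnds g (Fin.natAdd g i) b = if b then some i else none := by
  unfold starEnds
  rw [Fin.addCases_right]

lemma starEnds_val_none (g : ℕ) : (endsGraph (starEnds g)).val (none : Option (Fin g)) = g := by
  rw [endsGraph_val (starEnds g), Fin.sum_univ_add]
  simp only [starEnds_loop, starEnds_bridge]
  simp

lemma starEnds_val_some (i : Fin g) : (endsGraph (starEnds g)).val (some i) = 3 := by
  classical
  rw [endsGraph_val (starEnds g), Fin.sum_univ_add]
  simp only [starEnds_loop, starEnds_bridge]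
  simp [Finset.sum_add_distrib]

lemma starEnds_connected (g : ℕ) : (endsGraph (starEnds g)).Connected := by
  have h : ∀ v : Option (Fin g), (endsGraph (starEnds g)).joined Set.univ v none := by
    rintro (_ | i)
    · exact Setoid.refl' _ _
    · have := joined_endsGraph (starEnds g) (Fin.natAdd g i)
      rwa [starEnds_bridge, starEnds_bridge] at this
  exact ⟨⟨none⟩, fun u v => Setoid.trans' _ (h u) (Setoid.symm' _ (h v))⟩

/-- The star with `g` leaves and a loop at each leaf, with all markings at the centre. -/
noncomputable def star (g n : ℕ) (h : 3 ≤ g + n) : LabelledGraph g n (g + g) :=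
  ofEnds (starEnds g) (starEnds_connected g) (fun _ => none)
    (by rw [Fintype.card_option, Fintype.card_fin, add_assoc])
    (by
      -- The centre has valence `g` and all `n` markings; a leaf has valence three, two from its
      -- loop and one from its bridge.
      rintro (_ | i)
      · rw [starEnds_val_none]
        simp only [Nat.card_eq_fintype_card, Fintype.card_subtype_true, Fintype.card_fin]
        omega
      · rw [starEnds_val_some]
        omega)

lemma star_inc_loop (h : 3 ≤ g + n) (v : Option (Fin g)) (i : Fin g) :
    (star g n h).inc v (Fin.castAdd g i) ↔ v = some i := by
  refine (inc_ofEnds v _).trans ?_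
  rw [starEnds_loop, starEnds_loop, or_self]

lemma star_inc_bridge (h : 3 ≤ g + n) (v : Option (Fin g)) (i : Fin g) :
    (star g n h).inc v (Fin.natAdd g i) ↔ v = some i ∨ v = none := by
  refine (inc_ofEnds v _).trans ?_
  rw [starEnds_bridge, starEnds_bridge]
  rfl

/-! ### One-edge faces of the star and of its expansions -/

/-- The inclusion of a single label. -/
def single (l : Fin k) : Fin 1 ↪ Fin k := ⟨fun _ => l, fun _ _ _ => Subsingleton.elim _ _⟩

lemma notMem_range_single {l l' : Fin k} : l' ∉ Set.range (single l) ↔ l' ≠ l :=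
  not_congr ⟨fun ⟨_, h⟩ => h.symm, fun h => ⟨0, h.symm⟩⟩

lemma joined_of_card_face_eq_one {j : ℕ} {A : LabelledGraph g n k} {ι : Fin j ↪ Fin k}
    (h : Fintype.card (A.face ι).graph.V = 1) (u v : A.graph.V) :
    A.graph.joined (A.missed ι) u v := by
  have := Fintype.card_le_one_iff_subsingleton.1 h.le
  exact HGraph.comp_eq_iff.1 (this.elim (A.graph.comp (A.missed ι) u) (A.graph.comp _ v))

/-- The bridge is the only connection of leaf `i` to the rest, so contracting all other edges leaves
it apart. -/
lemma card_face_star_single (h : 3 ≤ g + n) (i : Fin g) :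
    Fintype.card ((star g n h).face (single (Fin.natAdd g i))).graph.V ≠ 1 := by
  intro hcard
  have hj := joined_of_card_face_eq_one hcard (some i : Option (Fin g)) (none : Option (Fin g))
  have key := joined_induction (P := fun u v : Option (Fin g) => u = some i ↔ v = some i)
    ⟨fun _ => Iff.rfl, Iff.symm, Iff.trans⟩ _ (fun l hl u v hu hv => ?_) hj
  · simp at key
  · rw [notMem_range_single] at hl
    induction l using Fin.addCases with
    | left i' =>
      replace hu := (star_inc_loop h u i').1 hu
      replace hv := (star_inc_loop h v i').1 hv
      rw [hu, hv]
    | right i' =>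
      replace hu := (star_inc_bridge h u i').1 hu
      replace hv := (star_inc_bridge h v i').1 hv
      have hi : i' ≠ i := fun h => hl (h ▸ rfl)
      rcases hu with rfl | rfl <;> rcases hv with rfl | rfl <;> simp [hi]

/-- All bridges are contracted, and they join every leaf to the centre. -/
lemma card_face_star_loops (h : 3 ≤ g + n) {j : ℕ} (κ : Fin j ↪ Fin (g + g))
    (hκ : ∀ i, ∃ i', κ i = Fin.castAdd g i') :
    Fintype.card ((star g n h).face κ).graph.V = 1 := by
  refine Fintype.card_eq_one_iff.2
    ⟨(star g n h).graph.comp _ (none : Option (Fin g)), fun c => ?_⟩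
  obtain ⟨v, rfl⟩ := HGraph.comp_surj _ c
  refine HGraph.comp_eq_iff.2 ?_
  change Option (Fin g) at v
  rcases v with _ | i
  · exact Setoid.refl' _ _
  · refine joined_of_inc κ (l := Fin.natAdd g i) ?_ ((star_inc_bridge h _ i).2 (Or.inl rfl))
      ((star_inc_bridge h _ i).2 (Or.inr rfl))
    rintro ⟨a, ha⟩
    obtain ⟨i', hi'⟩ := hκ a
    rw [hi'] at ha
    have := congrArg Fin.val ha
    simp at this
    omega

/-- An edge whose contraction gives the star of loops is a bridge. -/
lemma card_face_single_of_contract_star (h : 3 ≤ g + n) (A : LabelledGraph g n (g + g + 1))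
    (ψ : Iso (A.face (Fin.succAboveEmb (Fin.last _))) (star g n h)) :
    Fintype.card (A.face (single (Fin.last _))).graph.V ≠ 1 := by
  intro hcard
  let e : Fin (g + g + 1) := Fin.last _
  let f : A.graph.V → Option (Fin g) := fun v =>
    ψ.onV (A.graph.comp (A.missed (Fin.succAboveEmb e)) v)
  have hf : ∀ {u v}, f u = f v ↔ u = v ∨ A.inc u e ∧ A.inc v e := fun {u v} =>
    ψ.onV.injective.eq_iff.trans (HGraph.comp_eq_iff.trans (joined_succAbove_iff e))
  have hfsurj : Function.Surjective f := ψ.onV.surjective.comp (HGraph.comp_surj _)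
  have hinc : ∀ v l, (star g n h).inc (f v) l ↔ ∃ u, f u = f v ∧ A.inc u l.castSucc :=
    fun v l => by
      refine (ψ.inc_iff _ l).trans ((face_inc_iff _ v l).trans ?_)
      refine exists_congr fun u => ?_
      rw [hf, joined_succAbove_iff, ← Fin.succAbove_last]
      rfl
  have hfinc : ∀ v l, A.inc v l.castSucc → (star g n h).inc (f v) l := fun v l hv =>
    (hinc v l).2 ⟨v, rfl, hv⟩
  have hcV : Fintype.card (A.face (Fin.succAboveEmb e)).graph.V = g + 1 :=
    (Fintype.card_congr ψ.onV).trans (by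
      change Fintype.card (Option (Fin g)) = _
      rw [Fintype.card_option, Fintype.card_fin])
  -- With `e` a loop, `A` would have `2 * g + 1` edges on `g + 1` vertices, which exceeds the genus.
  have he : ¬ A.IsLoop e := fun he => by
    have h1 := card_face_of_isLoop he
    have h2 := A.genus_eq
    omega
  obtain ⟨u, v, huv, hends⟩ := A.two_ends he
  have hfuv : f v = f u := hf.2 (Or.inr ⟨(hends v).2 (Or.inr rfl), (hends u).2 (Or.inl rfl)⟩)
  rcases hq : f u with _ | i
  -- The centre is split into `u` and `v`. The predicate `χ` describes the side of `u`: the vertex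
  -- `u` and the leaves whose bridge ends at `u`. No edge except `e` changes sides.
  · let χ : A.graph.V → Prop := fun x =>
      (f x = none ∧ x = u) ∨ ∃ i, f x = some i ∧ A.inc u (Fin.natAdd g i).castSucc
    have hnone : ∀ x, f x = none → (χ x ↔ x = u) := fun x hx => by simp [χ, hx]
    have hsome : ∀ x i, f x = some i → (χ x ↔ A.inc u (Fin.natAdd g i).castSucc) :=
      fun x i hx => by simp [χ, hx]
    have hbridge : ∀ i x y, f x = some i → f y = none → A.inc y (Fin.natAdd g i).castSucc →
        A.inc x (Fin.natAdd g i).castSucc → (χ x ↔ χ y) := fun i x y hx hy hyi hxi => by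
      rw [hnone y hy, hsome x i hx]
      refine ⟨fun hui => ?_, fun h => h ▸ hyi⟩
      rcases A.eq_of_inc_three hui hyi hxi with h | h | h
      · exact h.symm
      · rw [h, hx] at hy; cases hy
      · rw [h, hx] at hq; cases hq
    have key := joined_induction (P := fun x y => χ x ↔ χ y)
      ⟨fun _ => Iff.rfl, Iff.symm, Iff.trans⟩ _ (fun l hl x y hx hy => ?_)
      (joined_of_card_face_eq_one hcard u v)
    · rw [hnone u hq, hnone v (hfuv.trans hq)] at key
      exact huv (key.1 rfl).symm
    · rw [notMem_range_single] at hl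
      obtain ⟨l, rfl⟩ := Fin.exists_castSucc_eq.2 hl
      have hx' := hfinc x l hx
      have hy' := hfinc y l hy
      induction l using Fin.addCases with
      | left i =>
        rw [star_inc_loop] at hx' hy'
        rw [hsome x i hx', hsome y i hy']
      | right i =>
        rw [star_inc_bridge] at hx' hy'
        rcases hx' with hx' | hx' <;> rcases hy' with hy' | hy'
        · rw [hsome x i hx', hsome y i hy']
        · exact hbridge i x y hx' hy' hy hx
        · exact (hbridge i y x hy' hx' hx hy).symm
        -- The bridge also has an end over its leaf, so its two ends over the centre coincide.
        · obtain ⟨z, hz⟩ := hfsurj (some i)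
          obtain ⟨z', hz', hzi⟩ := (hinc z _).1 (hz ▸ (star_inc_bridge h _ i).2 (Or.inl rfl))
          rw [hz] at hz'
          rcases A.eq_of_inc_three hx hy hzi with h | h | h
          · rw [h]
          · rw [← h, hy'] at hz'; cases hz'
          · rw [← h, hx'] at hz'; cases hz'
  -- A leaf cannot be split: it has weight zero, valence three and no marking, hence excess one,
  -- while two merged vertices need excess two.
  · have h1 := A.card_fiber_le_excess (Fin.succAboveEmb e)
      (A.graph.comp (A.missed (Fin.succAboveEmb e)) u)
    have hw := ψ.map_w (A.graph.comp (A.missed (Fin.succAboveEmb e)) u)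
    have hval := ψ.val_eq (A.graph.comp (A.missed (Fin.succAboveEmb e)) u)
    have hm := ψ.card_m_eq (A.graph.comp (A.missed (Fin.succAboveEmb e)) u)
    have hu : ψ.onV (A.graph.comp (A.missed (Fin.succAboveEmb e)) u) = some i := hq
    rw [hu] at hw hval hm
    have hw' : (star g n h).graph.w (some i : Option (Fin g)) = 0 := rfl
    have hval' : (star g n h).graph.val (some i : Option (Fin g)) = 3 := starEnds_val_some i
    have hm' : Nat.card {j : Fin n // (star g n h).graph.m j = (some i : Option (Fin g))} = 0 := by
      rw [Nat.card_eq_zero]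
      refine Or.inl ⟨?_⟩
      rintro ⟨j, hj⟩
      exact Option.some_ne_none i (Eq.symm hj)
    have h2 : 2 ≤ (A.graph.compVerts (A.missed (Fin.succAboveEmb e))
        (A.graph.comp (A.missed (Fin.succAboveEmb e)) u)).card := by
      refine Finset.one_lt_card.2 ⟨u, ?_, v, ?_, huv⟩
      · simp [HGraph.compVerts]
      · simp only [HGraph.compVerts, Finset.mem_filter, Finset.mem_univ, true_and]
        exact ψ.onV.injective hfuv
    rw [← hw, ← hval, ← hm] at h1
    omega

end LabelledGraph

/-! ## The number of vertices is preserved -/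

namespace SimplexAut

open LabelledGraph TropSimplex

variable {g n : ℕ}

/-- The rose is realized as a face, along `κ`, of a weightless `u` whose image has the star `T` as a
face along `ι`. The argument shows that `κ` only uses labels of loops of `T`, so the image of the
rose is a face of `T` in which all bridges are contracted. -/
lemma numVertices_rose_of_genus_edges (hg : 1 ≤ g) (h : 5 ≤ 2 * g + n) (F : SimplexAut g n)
    (x : TropSimplex g n g) (hx : x.numVertices = 1) : (F.toFun x).numVertices = 1 := by
  have hgn : 3 ≤ g + n := by omega
  let T := TropSimplex.mk (star g n hgn)
  obtain ⟨K, ι, u, hu, hnu, hK⟩ := exists_weightless_coface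
    (g + (F.invFun T).numVertices - (g + g + 1)) (F.invFun T) (by
      have := (F.invFun T).le_genus
      omega)
  have hpos := u.numVertices_pos
  obtain ⟨j, κ, hj, hκ⟩ := exists_face_numVertices_eq_one (u.numVertices - 1) u (by omega)
  -- A weightless graph has `g` edges outside a spanning tree.
  obtain rfl : g = j := by omega
  have hux : u.face κ = x := eq_of_numVertices_eq_one hκ hx
  have hT : (F.toFun u).face ι = T := by rw [← F.map_face, hu, F.to_inv]
  have hsingle : ∀ i, ((F.toFun u).face (single (κ i))).numVertices = 1 := fun i => by
    have h1 : (F.toFun u).face (single (κ i)) = F.toFun (x.face (single i)) := by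
      rw [← hux, TropSimplex.face_face, ← F.map_face]
      rfl
    rw [h1]
    refine F.numVertices_one_edge hg h _ ?_
    have h2 := numVertices_face_le (single i) x
    have h3 := (x.face (single i)).numVertices_pos
    omega
  -- The one-edge face at `κ i` has one vertex. This excludes the bridges of `T` and the edges that
  -- are contracted to reach `T`.
  have hmem : ∀ i, ∃ i', κ i = ι (Fin.castAdd g i') := fun i => by
    by_cases hi : κ i ∈ Set.range ι
    · obtain ⟨l, hl⟩ := hi
      induction l using Fin.addCases with
      | left i' => exact ⟨i', hl.symm⟩
      | right i' =>
        refine (card_face_star_single hgn i' ?_).elim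
        have h1 : (F.toFun u).face (single (κ i)) = T.face (single (Fin.natAdd g i')) := by
          rw [← hT, TropSimplex.face_face, ← hl]
          rfl
        have h2 := hsingle i
        rw [h1] at h2
        exact h2
    -- Keeping `κ i` in addition to the edges of `T` gives a graph that becomes `T` on contraction
    -- of its last edge; that edge is a bridge.
    · let ι' : Fin (g + g + 1) ↪ Fin K := ⟨Fin.snoc ι (κ i), by
        rw [Fin.snoc_injective_iff]
        exact ⟨ι.injective, hi⟩⟩
      obtain ⟨A, hA⟩ := mk_surj ((F.toFun u).face ι')
      have h1 : (Fin.succAboveEmb (Fin.last (g + g))).trans ι' = ι := by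
        ext l
        simp [ι']
      have h2 : (TropSimplex.mk A).face (Fin.succAboveEmb (Fin.last (g + g))) = T := by
        rw [hA, TropSimplex.face_face, h1, hT]
      obtain ⟨ψ⟩ := mk_eq_iff.1 h2
      refine (card_face_single_of_contract_star hgn A ψ ?_).elim
      have h3 : (TropSimplex.mk A).face (single (Fin.last (g + g))) = (F.toFun u).face (single (κ i)) := by
        rw [hA, TropSimplex.face_face]
        congr 1
        ext l
        exact congrArg Fin.val (Fin.snoc_last (α := fun _ => Fin K) (κ i) ι)
      have h4 := hsingle i
      rw [← h3] at h4
      exact h4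
  choose lam hlam using hmem
  let κ' : Fin g ↪ Fin (g + g) := ⟨fun i => Fin.castAdd g (lam i), fun a b hab =>
    κ.injective (by rw [hlam, hlam]; exact congrArg ι hab)⟩
  have hκ' : κ = κ'.trans ι := by
    ext i
    exact congrArg Fin.val (hlam i)
  rw [← hux, F.map_face, hκ', ← TropSimplex.face_face, hT]
  exact card_face_star_loops hgn κ' fun i => ⟨lam i, rfl⟩

/-- For `g ≥ 1`, trading weight for loops makes every rose a face of the one with `g` loops, and
faces of roses are roses. For `g = 0` a rose has no edges, and a connected graph without edges has
one vertex. -/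
lemma numVertices_rose (h : 5 ≤ 2 * g + n) (F : SimplexAut g n) {k : ℕ} (x : TropSimplex g n k)
    (hx : x.numVertices = 1) : (F.toFun x).numVertices = 1 := by
  have hle := x.le_genus
  by_cases hg : 1 ≤ g
  · obtain ⟨K, ι, y, rfl, hny, hK⟩ := exists_weightless_coface (g + x.numVertices - (k + 1)) x
      (by omega)
    obtain rfl : K = g := by omega
    have h1 := F.numVertices_rose_of_genus_edges hg h y (by omega)
    have h2 := numVertices_face_le ι (F.toFun y)
    rw [← F.map_face] at h2
    have h3 := (F.toFun (y.face ι)).numVertices_pos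
    omega
  · have hpos := (F.toFun x).numVertices_pos
    obtain ⟨j, -, hj, -⟩ := exists_face_numVertices_eq_one ((F.toFun x).numVertices - 1)
      (F.toFun x) (by omega)
    omega

end SimplexAut

/-- For `2g - 2 + n ≥ 3`, automorphisms of `Δ_{g,n}` restrict to `V²_{g,n}`, and the restriction map
`Aut(Δ_{g,n}) → Aut(V²_{g,n})` is injective. -/
theorem theorem1p5 (g n : ℕ) (hgn : 3 ≤ 2 * (g : ℤ) - 2 + n) :
    ∃ ρ : Aut (tropicalModuli g n) →* Aut (vertexSubcomplex g n 2).toFunctor,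
      IsRestriction (vertexSubcomplex g n 2) ρ ∧ Function.Injective ρ :=
  restrict_injective_of_numVertices fun F {_} x => F.numVertices_eq_of_roses
    (fun F {_} x hx => F.numVertices_rose (by omega) x hx) x
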